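/- Conventions. A *reduced crossed complex* $C=(\cdots\to C_n\xrightarrow{\delta_n}C_{n-1}\to\cdots\to C_2\xrightarrow{\delta_2}C_1)$ is a crossed complex over a one-point object set; $\pi_1C=\operatorname{Coker}\delta_2$ and $H_i(C)=\operatorname{Ker}\delta_i/\operatorname{Im}\delta_{i+1}$ for $i\ge 2$. It is *$n$-aspherical* if $H_i(C)=0$ for $1<i<n$. A reduced crossed complex $F$ is *free* if $F_1$ is a free group, $\delta_2:F_2\to F_1$ is a free crossed module, and $F_i$ is a free $\mathbb Z[\pi_1F]$-module for $i\ge3$. Homotopies of morphisms of reduced crossed complexes are pointed. Let $\phi:F_1\to\pi_1F$ be the quotient map. For a group $Q$, a $Q$-module $A$ and $m\ge2$, $\mathbb K(Q,1;A,m)$ is the crossed complex with $Q$ in dimension $1$, $A$ in dimension $m$ (with the given action), and zero boundaries. For $\theta:\pi_1F\to Q$, $H^m_{\theta\phi}(F,A)$ is the set of homotopy classes of morphisms $F\to\mathbb K(Q,1;A,m)$ equal to $\theta\phi$ in dimension $1$; it is an abelian group under addition of values in dimension $m$, its zero being the class of the morphism that is trivial in dimensions $\ge 2$. **Theorem.**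 Let $n\ge2$, let $F$ be a reduced free crossed complex, and let $C$ be a reduced $n$-aspherical crossed complex with $C_i=0$ for $i>n$. Put $\Phi=\pi_1F$, $Q=\pi_1C$ and $A=\operatorname{Ker}(\delta_n:C_n\to C_{n-1})$ (with $C_0$ the trivial group), a $Q$-module. Let $\xi C$ be the crossed complex obtained from $C$ by adding $A$ in dimension $n+1$, with boundary the inclusion $A\to C_n$, and let $p:\xi C\to\mathbb K(Q,1;A,n+1)$ be the projection (the quotient map $C_1\to Q$ in dimension $1$, the identity of $A$ in dimension $n+1$). Let $\theta:\Phi\to Q$ be a morphism of groups. Then: 1. There exist morphisms $f':F\to\xi C$ inducing $\theta$ on fundamental groups, and the class $k_\theta=[p f']\in H^{n+1}_{\theta\phi}(F,A)$ is the same for all of them; $k_\theta$ is called the obstruction class of $\theta$. 2. $k_\theta=0$ if and only if $\theta$ is induced by some morphism $F\to C$. 3. If $k_\theta=0$, then the set $[F,C;\theta\phi]$ of homotopy classes of morphisms $F\to C$ inducing $\theta$ is in bijection with $H^n_{\theta\phi}(F,A)$. Moreover $H^n_{\theta\phi}(F,A)$ acts on $[F,C;\theta\phi]$ by addition of values in $A\subseteq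 C_n$ in dimension $n$; this action is free, and for each class $x\in[F,C;\theta\phi]$ the map $a\mapsto a\cdot x$ is a bijection $H^n_{\theta\phi}(F,A)\to[F,C;\theta\phi]$. -/

import Mathlib

universe u

/-- A reduced crossed complex (one object), written multiplicatively and with left actions.
`X n` is the group in dimension `n`; `X 0` is the one-point set of objects, regarded as a trivial
group.  The group `X 1` acts on every `X n`, on itself by conjugation, and
`δ n : X (n + 1) → X n` is the boundary. -/
structure RedCrossedComplex where
  X : ℕ → Type u
  [grp : ∀ n, Group (X n)]
  pt : Subsingleton (X 0)
  act : ∀ n, X 1 →* MulAut (X n)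
  δ : ∀ n, X (n + 1) →* X n
  act_conj : ∀ g x : X 1, act 1 g x = g * x * g⁻¹
  δ_act : ∀ n (g : X 1) (x : X (n + 1)), δ n (act (n + 1) g x) = act n g (δ n x)
  δ_δ : ∀ n (x : X (n + 2)), δ n (δ (n + 1) x) = 1
  peiffer : ∀ x y : X 2, act 2 (δ 1 x) y = x * y * x⁻¹
  comm : ∀ n, 3 ≤ n → ∀ x y : X n, x * y = y * x
  act_triv : ∀ n, 3 ≤ n → ∀ (x : X 2) (y : X n), act n (δ 1 x) y = y

namespace RedCrossedComplex

attribute [instance] RedCrossedComplex.grp RedCrossedComplex.pt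

section basics

variable (C : RedCrossedComplex.{u})

instance normal_range : (C.δ 1).range.Normal where
  conj_mem := by
    rintro _ ⟨x, rfl⟩ g
    exact ⟨C.act 2 g x, by rw [C.δ_act, C.act_conj]⟩

/-- The fundamental group: the cokernel of `δ₂ : C₂ → C₁`. -/
abbrev π₁ : Type u := C.X 1 ⧸ (C.δ 1).range

/-- The quotient morphism `C₁ → π₁ C`. -/
abbrev φ : C.X 1 →* C.π₁ := QuotientGroup.mk' (C.δ 1).range

/-- The kernel of the boundary `Cₙ → Cₙ₋₁`, as a subgroup of `Cₙ`. -/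
def cyc : ∀ n, Subgroup (C.X n)
  | 0 => ⊤
  | n + 1 => (C.δ n).ker

/-- `C` is `n`-aspherical: `Hᵢ(C) = Ker δᵢ / Im δᵢ₊₁` vanishes for `1 < i < n`
(connectedness is automatic, as `C` is reduced). -/
def IsAspherical (n : ℕ) : Prop :=
  ∀ i, 1 < i → i < n → C.cyc i ≤ (C.δ i).range

theorem cyc_act (n : ℕ) (g : C.X 1) (a : C.X n) (ha : a ∈ C.cyc n) :
    C.act n g a ∈ C.cyc n := by
  cases n with
  | zero => exact Subgroup.mem_top _
  | succ n =>
    have ha' : C.δ n a = 1 := ha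
    change C.δ n _ = 1
    rw [C.δ_act, ha', map_one]

theorem cyc_central (n : ℕ) (hn : 2 ≤ n) (a : C.X n) (ha : a ∈ C.cyc n) (x : C.X n) :
    a * x = x * a := by
  rcases Nat.lt_or_ge 2 n with h | h
  · exact C.comm n h a x
  · obtain rfl : n = 2 := le_antisymm h hn
    have ha' : C.δ 1 a = 1 := ha
    have := C.peiffer a x
    rw [ha', map_one, MulAut.one_apply] at this
    exact (eq_mul_inv_iff_mul_eq.1 this).symm

theorem cyc_act_δ (n : ℕ) (hn : 2 ≤ n) (x : C.X 2) (a : C.X n) (ha : a ∈ C.cyc n) :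
    C.act n (C.δ 1 x) a = a := by
  rcases Nat.lt_or_ge 2 n with h | h
  · exact C.act_triv n h x a
  · obtain rfl : n = 2 := le_antisymm h hn
    rw [C.peiffer, ← C.cyc_central 2 le_rfl a ha x, mul_inv_cancel_right]

end basics

/-- Restriction of an action by automorphisms to an invariant subgroup. -/
def restrictAct {G A : Type u} [Group G] [Group A] (ρ : G →* MulAut A) (S : Subgroup A)
    (h : ∀ g, ∀ a ∈ S, ρ g a ∈ S) : G →* MulAut S where
  toFun g :=
    { toFun := fun a => ⟨ρ g a, h g a a.2⟩
      invFun := fun a => ⟨ρ g⁻¹ a, h g⁻¹ a a.2⟩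
      left_inv := fun a => Subtype.ext (by simp)
      right_inv := fun a => Subtype.ext (by simp)
      map_mul' := fun a b => Subtype.ext (by simp) }
  map_one' := by ext a; simp
  map_mul' g g' := by ext a; simp

@[simp] theorem restrictAct_coe {G A : Type u} [Group G] [Group A] (ρ : G →* MulAut A)
    (S : Subgroup A) (h : ∀ g, ∀ a ∈ S, ρ g a ∈ S) (g : G) (a : S) :
    (restrictAct ρ S h g a : A) = ρ g a := rfl

section moduleA

variable (C : RedCrossedComplex.{u}) (n : ℕ) (hn : 2 ≤ n)

/-- The abelian group `A = Ker (δₙ : Cₙ → Cₙ₋₁)`, for `n ≥ 2`. -/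
def A (_ : 2 ≤ n) : Type u := C.cyc n

instance : CommGroup (C.A n hn) :=
  { (C.cyc n).toGroup with
    mul_comm := fun a b => Subtype.ext (C.cyc_central n hn a.1 a.2 b.1) }

/-- The inclusion of `A` in `Cₙ`. -/
def incl : C.A n hn →* C.X n := (C.cyc n).subtype

/-- The action of `π₁ C` on `A` induced by the action of `C₁` on `Cₙ`. -/
def actA : C.π₁ →* MulAut (C.A n hn) :=
  QuotientGroup.lift (C.δ 1).range (restrictAct (C.act n) (C.cyc n) (C.cyc_act n)) (by
    rintro _ ⟨x, rfl⟩
    exact MulEquiv.ext fun a => Subtype.ext (C.cyc_act_δ n hn x a.1 a.2))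

theorem incl_actA (g : C.X 1) (a : C.A n hn) :
    C.incl n hn (C.actA n hn (C.φ g) a) = C.act n g (C.incl n hn a) := rfl

/-- The morphism `A → Cᵢ` which is the inclusion for `i = n` and trivial for `i ≠ n`. -/
def inc (i : ℕ) : C.A n hn →* C.X i :=
  if h : n = i then h ▸ C.incl n hn else 1

theorem inc_self : C.inc n hn n = C.incl n hn := by simp [inc]

theorem inc_ne (i : ℕ) (h : n ≠ i) : C.inc n hn i = 1 := by simp [inc, h]

theorem inc_act (i : ℕ) (g : C.X 1) (a : C.A n hn) :
    C.inc n hn i (C.actA n hn (C.φ g) a) = C.act i g (C.inc n hn i a) := by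
  by_cases h : n = i
  · subst h; rw [inc_self, incl_actA]
  · rw [inc_ne _ _ _ _ h]; simp

theorem inc_mem (i : ℕ) (a : C.A n hn) : C.inc n hn i a ∈ C.cyc i := by
  by_cases h : n = i
  · subst h; rw [inc_self]; exact a.2
  · rw [inc_ne _ _ _ _ h]; exact one_mem _

theorem δ_inc (i : ℕ) (a : C.A n hn) : C.δ i (C.inc n hn (i + 1) a) = 1 :=
  C.inc_mem n hn (i + 1) a

theorem inc_central (i : ℕ) (a : C.A n hn) (x : C.X i) :
    C.inc n hn i a * x = x * C.inc n hn i a := by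
  by_cases h : n = i
  · subst h; exact C.cyc_central n hn _ (C.inc_mem n hn n a) x
  · rw [inc_ne _ _ _ _ h]; simp

end moduleA

/-! ### Free reduced crossed complexes -/

section free

variable (F : RedCrossedComplex.{u})

instance commGroupX (i : ℕ) : CommGroup (F.X (i + 3)) :=
  { F.grp (i + 3) with mul_comm := F.comm (i + 3) (by omega) }

/-- The action of `π₁ F` on `Fₙ`, `n ≥ 3`. -/
def actπ (i : ℕ) : F.π₁ →* MulAut (F.X (i + 3)) :=
  QuotientGroup.lift (F.δ 1).range (F.act (i + 3)) (by
    rintro _ ⟨x, rfl⟩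
    ext a
    exact F.act_triv (i + 3) (by omega) x a)

/-- `Fₙ`, `n ≥ 3`, as an integral representation of `π₁ F`, i.e. a `ℤ[π₁ F]`-module. -/
def repX (i : ℕ) : Representation ℤ F.π₁ (Additive (F.X (i + 3))) where
  toFun g := (MonoidHom.toAdditive (F.actπ i g).toMonoidHom).toIntLinearMap
  map_one' := by ext x; simp
  map_mul' g g' := by ext x; simp

/-- `δ₂ : F₂ → F₁` is the free crossed `F₁`-module on the family `b : B → F₂`. -/
def IsFreeCrossedModuleOn {B : Type u} (b : B → F.X 2) : Prop :=
  ∀ (M : Type u) [Group M] (α : F.X 1 →* MulAut M) (μ : M →* F.X 1),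
    (∀ g m, μ (α g m) = g * μ m * g⁻¹) → (∀ m m' : M, α (μ m) m' = m * m' * m⁻¹) →
    ∀ s : B → M, (∀ x, μ (s x) = F.δ 1 (b x)) →
      ∃! ψ : F.X 2 →* M, (∀ g x, ψ (F.act 2 g x) = α g (ψ x)) ∧ (∀ x, μ (ψ x) = F.δ 1 x) ∧
        ∀ x, ψ (b x) = s x

/-- The reduced crossed complex `F` is free, i.e. obtained from a point by attaching cells in order
of increasing dimension: `F₁` is a free group, `F₂ → F₁` is a free crossed module, and `Fₙ` is a
free `ℤ[π₁ F]`-module for `n ≥ 3`. -/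
structure IsFree : Prop where
  one : IsFreeGroup (F.X 1)
  two : ∃ (B : Type u) (b : B → F.X 2), F.IsFreeCrossedModuleOn b
  three : ∀ i, Module.Free (MonoidAlgebra ℤ F.π₁) (F.repX i).asModule

end free

/-! ### Morphisms and pointed homotopies -/

/-- Morphisms of reduced crossed complexes. -/
@[ext] structure Hom (F C : RedCrossedComplex.{u}) where
  map : ∀ n, F.X n →* C.X n
  map_δ : ∀ n (x : F.X (n + 1)), map n (F.δ n x) = C.δ n (map (n + 1) x)
  map_act : ∀ n (g : F.X 1) (x : F.X n), map n (F.act n g x) = C.act n (map 1 g) (map n x)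

/-- Composition `q ∘ f` of morphisms. -/
def Hom.comp {F C D : RedCrossedComplex.{u}} (q : Hom C D) (f : Hom F C) : Hom F D where
  map n := (q.map n).comp (f.map n)
  map_δ n x := by simp [f.map_δ, q.map_δ]
  map_act n g x := by simp [f.map_act, q.map_act]

/-- A (left, pointed) homotopy `h : f ≃ g` of morphisms `F → C`: functions `hₙ : Fₙ → Cₙ₊₁` with
`h₀` trivial, `h₁` a derivation over `g₁`, and `hₙ` for `n ≥ 2` an operator morphism over `g₁`,
such that `f₁ x = δ(h₁ x) · g₁ x` and `fₙ x = hₙ₋₁(δ x) · δ(hₙ x) · gₙ x` for `n ≥ 2`. -/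
structure Homotopy {F C : RedCrossedComplex.{u}} (f g : Hom F C) where
  h : ∀ n, F.X n → C.X (n + 1)
  h_zero : ∀ x, h 0 x = 1
  h_one : ∀ x y, h 1 (x * y) = h 1 x * C.act 2 (g.map 1 x) (h 1 y)
  h_mul : ∀ n, 2 ≤ n → ∀ x y, h n (x * y) = h n x * h n y
  h_act : ∀ n, 2 ≤ n → ∀ u x, h n (F.act n u x) = C.act (n + 1) (g.map 1 u) (h n x)
  h_eq : ∀ n x, f.map (n + 1) x =
    h n (F.δ n x) * C.δ (n + 1) (h (n + 1) x) * g.map (n + 1) x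

/-- `f` and `g` are (pointed) homotopic. -/
def Homotopic {F C : RedCrossedComplex.{u}} (f g : Hom F C) : Prop := Nonempty (Homotopy f g)

section homotopy

variable {F C : RedCrossedComplex.{u}}

theorem δ_central (n : ℕ) (z : C.X (n + 3)) (x : C.X (n + 2)) :
    C.δ (n + 2) z * x = x * C.δ (n + 2) z :=
  C.cyc_central (n + 2) (by omega) _ (C.δ_δ (n + 1) z) x

theorem Homotopy.eq_one {f g : Hom F C} (H : Homotopy f g) (x : F.X 1) :
    f.map 1 x = C.δ 1 (H.h 1 x) * g.map 1 x := by
  rw [H.h_eq 0 x, H.h_zero, one_mul]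

theorem Homotopy.act_eq {f g : Hom F C} (H : Homotopy f g) (n : ℕ) (hn : 3 ≤ n) (u : F.X 1)
    (y : C.X n) : C.act n (f.map 1 u) y = C.act n (g.map 1 u) y := by
  rw [H.eq_one, map_mul, MulAut.mul_apply, C.act_triv n hn]

theorem Homotopic.refl (f : Hom F C) : Homotopic f f :=
  ⟨{ h := fun _ _ => 1
     h_zero := by simp
     h_one := by simp
     h_mul := by simp
     h_act := by simp
     h_eq := by simp }⟩

theorem Homotopic.symm {f g : Hom F C} : Homotopic f g → Homotopic g f := by
  rintro ⟨H⟩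
  refine ⟨{ h := fun n x => (H.h n x)⁻¹, h_zero := ?_, h_one := ?_, h_mul := ?_, h_act := ?_,
            h_eq := ?_ }⟩
  · simp [H.h_zero]
  · intro x y
    rw [H.h_one, H.eq_one, map_mul, MulAut.mul_apply, C.peiffer, map_inv]
    group
  · intro n hn x y
    rw [H.h_mul n hn, mul_inv_rev, C.comm (n + 1) (by omega)]
  · intro n hn u x
    rw [H.h_act n hn, H.act_eq (n + 1) (by omega), map_inv]
  · intro n x
    rw [H.h_eq n x]
    rcases n with _ | n
    · simp [H.h_zero]
    · rw [map_inv, ← δ_central n (H.h (n + 2) x)]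
      have h1 := δ_central (C := C) n (H.h (n + 2) x) (H.h (n + 1) (F.δ (n + 1) x))⁻¹
      rw [mul_assoc (C.δ (n + 2) (H.h (n + 2) x)), mul_assoc (H.h (n + 1) (F.δ (n + 1) x))⁻¹]
      simp only [inv_mul_cancel_left]

theorem Homotopic.trans {f g k : Hom F C} : Homotopic f g → Homotopic g k → Homotopic f k := by
  rintro ⟨H⟩ ⟨K⟩
  refine ⟨{ h := fun n x => H.h n x * K.h n x, h_zero := ?_, h_one := ?_, h_mul := ?_,
            h_act := ?_, h_eq := ?_ }⟩
  · simp [H.h_zero, K.h_zero]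
  · intro x y
    rw [H.h_one, K.h_one, K.eq_one, map_mul, MulAut.mul_apply, C.peiffer, map_mul]
    group
  · intro n hn x y
    rw [H.h_mul n hn, K.h_mul n hn]
    simp only [mul_assoc]
    rw [← mul_assoc (H.h n y), C.comm (n + 1) (by omega) (H.h n y)]
    simp only [mul_assoc]
  · intro n hn u x
    rw [H.h_act n hn, K.h_act n hn, K.act_eq (n + 1) (by omega), map_mul]
  · intro n x
    rw [H.h_eq n x, K.h_eq n x]
    rcases n with _ | n
    · simp [H.h_zero, K.h_zero, mul_assoc]
    · rw [map_mul]
      simp only [mul_assoc]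
      rw [← mul_assoc (C.δ (n + 2) (H.h (n + 2) x)), δ_central n (H.h (n + 2) x)]
      simp only [mul_assoc]

end homotopy

/-- Pointed homotopy on the set of morphisms `F → C` with the property `P`. -/
def homSetoid (F C : RedCrossedComplex.{u}) (P : Hom F C → Prop) : Setoid {f : Hom F C // P f} where
  r f g := Homotopic f.1 g.1
  iseqv := ⟨fun f => Homotopic.refl f.1, fun h => h.symm, fun h h' => h.trans h'⟩

/-- The morphism `f : F → C` realises `θ : π₁ F → π₁ C`, i.e. induces `θ` on fundamental groups. -/
def Realises {F C : RedCrossedComplex.{u}} (θ : F.π₁ →* C.π₁) (f : Hom F C) : Prop :=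
  ∀ x, C.φ (f.map 1 x) = θ (F.φ x)

/-- `[F, C; θφ]`: the set of pointed homotopy classes of morphisms `F → C` realising `θ`. -/
def Classes (F C : RedCrossedComplex.{u}) (θ : F.π₁ →* C.π₁) : Type u :=
  Quotient (homSetoid F C (Realises θ))

/-! ### The crossed complex `K(Q, 1; A, m)` and cohomology -/

/-- The subgroup of `A` which is all of `A` if `p` holds and is trivial otherwise. -/
def sub (A : Type u) [Group A] (p : Prop) : Subgroup A where
  carrier := {a | p ∨ a = 1}
  one_mem' := Or.inr rfl
  mul_mem' := by
    rintro a b (h | rfl) (h' | rfl)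
    · exact Or.inl h
    · exact Or.inl h
    · exact Or.inl h'
    · exact Or.inr (mul_one 1)
  inv_mem' := by
    rintro a (h | rfl)
    · exact Or.inl h
    · exact Or.inr inv_one

theorem sub_act {G A : Type u} [Group G] [Group A] (ρ : G →* MulAut A) (p : Prop) (g : G) :
    ∀ a ∈ sub A p, ρ g a ∈ sub A p := by
  rintro a (h | rfl)
  · exact Or.inl h
  · exact Or.inr (map_one _)

section K

variable (Q A : Type u) [Group Q] [CommGroup A]

/-- The groups of `K(Q, 1; A, m)`: `Q` in dimension `1`, `A` in dimension `m`, trivial elsewhere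
(for `m ≥ 2`). -/
def KX (m : ℕ) : ℕ → Type u
  | 0 => PUnit
  | 1 => Q
  | i + 2 => sub A (i + 2 = m)

instance KX.group (m : ℕ) : ∀ i, Group (KX Q A m i)
  | 0 => inferInstanceAs (Group PUnit)
  | 1 => inferInstanceAs (Group Q)
  | i + 2 => inferInstanceAs (Group (sub A (i + 2 = m)))

/-- An element of `Q`, regarded as an element of dimension `1` of `K(Q, 1; A, m)`. -/
abbrev KX.ofQ {Q : Type u} (A : Type u) [Group Q] [CommGroup A] (m : ℕ) (q : Q) : KX Q A m 1 := q

variable {Q A}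

/-- The action of `Q` on the groups of `K(Q, 1; A, m)`. -/
def KX.act (ρ : Q →* MulAut A) (m : ℕ) : ∀ i, Q →* MulAut (KX Q A m i)
  | 0 => 1
  | 1 => MulAut.conj
  | i + 2 => restrictAct ρ (sub A (i + 2 = m)) (sub_act ρ _)

/-- The reduced crossed complex `K(Q, 1; A, m)`, `m ≥ 2`, for a `Q`-module `A` with action `ρ`:
all boundaries are trivial. -/
def K (ρ : Q →* MulAut A) (m : ℕ) : RedCrossedComplex.{u} where
  X := KX Q A m
  pt := inferInstanceAs (Subsingleton PUnit)
  act := KX.act ρ m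
  δ _ := 1
  act_conj g x := MulAut.conj_apply g x
  δ_act n g x := by simp
  δ_δ _ _ := rfl
  peiffer x y := by
    have : x * y = y * x := mul_comm (G := sub A (0 + 2 = m)) x y
    change KX.act ρ m 2 (1 : Q) y = x * y * x⁻¹
    rw [map_one, MulAut.one_apply, this, mul_inv_cancel_right]
  comm n hn x y := by
    obtain ⟨i, rfl⟩ : ∃ i, n = i + 2 := ⟨n - 2, by omega⟩
    exact mul_comm (G := sub A (i + 2 = m)) x y
  act_triv n _ x y := by
    change KX.act ρ m n (1 : Q) y = y
    rw [map_one, MulAut.one_apply]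

/-- The value in `A` of an element of `K(Q, 1; A, m)` of dimension `i + 2`. -/
def Kval (ρ : Q →* MulAut A) (m i : ℕ) : (K ρ m).X (i + 2) →* A :=
  (sub A (i + 2 = m)).subtype

variable {F : RedCrossedComplex.{u}}

/-- The morphism `f : F → K(Q, 1; A, m)` induces `θ : π₁ F → Q`, i.e. is `θφ` in dimension `1`. -/
def Over (θ : F.π₁ →* Q) (ρ : Q →* MulAut A) (m : ℕ) (f : Hom F (K ρ m)) : Prop :=
  ∀ x : F.X 1, f.map 1 x = KX.ofQ A m (θ (F.φ x))

/-- The cohomology `H^m_{θφ}(F, A) = [F, K(Q, 1; A, m); θφ]_*`, for `m ≥ 2`. -/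
def Cohomology (θ : F.π₁ →* Q) (ρ : Q →* MulAut A) (m : ℕ) : Type u :=
  Quotient (homSetoid F (K ρ m) (Over θ ρ m))

variable {θ : F.π₁ →* Q} {ρ : Q →* MulAut A} {m : ℕ}

/-- A morphism `F → K(Q, 1; A, m)` over `θφ` from its values in dimensions `≥ 2`. -/
def KHom (θ : F.π₁ →* Q) (ρ : Q →* MulAut A) (m : ℕ)
    (c : ∀ i, F.X (i + 2) →* (K ρ m).X (i + 2))
    (hδ : ∀ i x, c i (F.δ (i + 2) x) = 1)
    (hact : ∀ i g x, c i (F.act (i + 2) g x) =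
      (K ρ m).act (i + 2) (KX.ofQ A m (θ (F.φ g))) (c i x)) :
    {f : Hom F (K ρ m) // Over θ ρ m f} :=
  ⟨{ map := fun i => match i with
      | 0 => 1
      | 1 => θ.comp F.φ
      | i + 2 => c i
     map_δ := fun i => match i with
      | 0 => fun _ => rfl
      | 1 => fun x => by
          change θ (F.φ (F.δ 1 x)) = (1 : Q)
          rw [show F.φ (F.δ 1 x) = 1 from (QuotientGroup.eq_one_iff _).2 ⟨x, rfl⟩, map_one]
      | i + 2 => fun x => hδ i x
     map_act := fun i => match i with
      | 0 => fun g x => rfl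
      | 1 => fun g x => by
          change θ (F.φ (F.act 1 g x)) = θ (F.φ g) * θ (F.φ x) * (θ (F.φ g))⁻¹
          rw [F.act_conj]; simp
      | i + 2 => fun g x => hact i g x }, fun _ => rfl⟩

theorem KX_mul_comm (i : ℕ) (x y : (K ρ m).X (i + 2)) : x * y = y * x :=
  mul_comm (G := sub A (i + 2 = m)) x y

theorem Kδ (i : ℕ) (x : (K ρ m).X (i + 1)) : (K ρ m).δ i x = 1 := rfl

theorem Over.map_δ {f : Hom F (K ρ m)} (i : ℕ) (x : F.X (i + 1)) : f.map i (F.δ i x) = 1 := by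
  rw [f.map_δ, Kδ]

/-- Addition of morphisms over `θφ`: addition of values. -/
def KAdd (f g : {f : Hom F (K ρ m) // Over θ ρ m f}) : {f : Hom F (K ρ m) // Over θ ρ m f} :=
  KHom θ ρ m
    (fun i => { toFun := fun x => f.1.map (i + 2) x * g.1.map (i + 2) x
                map_one' := by simp
                map_mul' := fun x y => by
                  rw [map_mul, map_mul, mul_assoc, mul_assoc,
                    ← mul_assoc (f.1.map (i + 2) y), KX_mul_comm i (f.1.map (i + 2) y),
                    mul_assoc] })
    (fun i x => by simp [Over.map_δ])
    (fun i u x => by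
      change f.1.map (i + 2) _ * g.1.map (i + 2) _ = _
      rw [f.1.map_act, g.1.map_act, f.2 u, g.2 u, ← map_mul]; rfl)

/-- The zero morphism over `θφ`: `θφ` in dimension `1` and trivial elsewhere. -/
def KZero (θ : F.π₁ →* Q) (ρ : Q →* MulAut A) (m : ℕ) : {f : Hom F (K ρ m) // Over θ ρ m f} :=
  KHom θ ρ m (fun _ => 1) (fun _ _ => rfl) (fun _ _ _ => by simp)

/-- The negative of a morphism over `θφ`. -/
def KNeg (f : {f : Hom F (K ρ m) // Over θ ρ m f}) : {f : Hom F (K ρ m) // Over θ ρ m f} :=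
  KHom θ ρ m
    (fun i => { toFun := fun x => (f.1.map (i + 2) x)⁻¹
                map_one' := by simp
                map_mul' := fun x y => by rw [map_mul, mul_inv_rev, KX_mul_comm] })
    (fun i x => by simp [Over.map_δ])
    (fun i u x => by
      change (f.1.map (i + 2) _)⁻¹ = _
      rw [f.1.map_act, f.2 u, ← map_inv]; rfl)

theorem KHom_ext {f g : {f : Hom F (K ρ m) // Over θ ρ m f}}
    (h : ∀ i x, f.1.map (i + 2) x = g.1.map (i + 2) x) : f = g := by
  apply Subtype.ext
  apply Hom.ext
  funext i
  ext x
  match i, x with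
  | 0, x => rfl
  | 1, x => rw [f.2 x, g.2 x]
  | i + 2, x => exact h i x

theorem KAdd_homotopic {f f' g g' : {f : Hom F (K ρ m) // Over θ ρ m f}}
    (hf : Homotopic f.1 f'.1) (hg : Homotopic g.1 g'.1) :
    Homotopic (KAdd f g).1 (KAdd f' g').1 := by
  obtain ⟨H⟩ := hf
  obtain ⟨L⟩ := hg
  refine ⟨{ h := fun i x => H.h i x * L.h i x, h_zero := ?_, h_one := ?_, h_mul := ?_,
            h_act := ?_, h_eq := ?_ }⟩
  · simp [H.h_zero, L.h_zero]
  · intro x y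
    rw [H.h_one, L.h_one, f'.2 x, g'.2 x, (KAdd f' g').2 x, map_mul]
    simp only [mul_assoc]
    rw [← mul_assoc (L.h 1 x), KX_mul_comm 0 (L.h 1 x), mul_assoc]
    exact congrArg _ ((congrArg _ (KX_mul_comm (ρ := ρ) 0 _ _)).trans
      (by simp only [← mul_assoc]; rw [KX_mul_comm 0 (L.h 1 x)]))
  · intro n hn x y
    rw [H.h_mul n hn, L.h_mul n hn]
    simp only [mul_assoc]
    rw [← mul_assoc (H.h n y), (K ρ m).comm (n + 1) (by omega) (H.h n y), mul_assoc]
  · intro n hn u x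
    rw [H.h_act n hn, L.h_act n hn, f'.2 u, g'.2 u, (KAdd f' g').2 u, map_mul]
  · intro n x
    rcases n with _ | n
    · rw [H.h_zero, L.h_zero, Kδ, (KAdd f g).2, (KAdd f' g').2, one_mul, one_mul]; exact (one_mul _).symm
    · change f.1.map (n + 2) x * g.1.map (n + 2) x =
        _ * _ * (f'.1.map (n + 2) x * g'.1.map (n + 2) x)
      rw [H.h_eq (n + 1) x, L.h_eq (n + 1) x, Kδ, Kδ, Kδ]
      simp only [mul_one, mul_assoc]
      rw [← mul_assoc (f'.1.map (n + 2) x), KX_mul_comm n (f'.1.map (n + 2) x), mul_assoc]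

theorem KNeg_homotopic {f f' : {f : Hom F (K ρ m) // Over θ ρ m f}}
    (hf : Homotopic f.1 f'.1) : Homotopic (KNeg f).1 (KNeg f').1 := by
  obtain ⟨H⟩ := hf
  refine ⟨{ h := fun i x => (H.h i x)⁻¹, h_zero := ?_, h_one := ?_, h_mul := ?_,
            h_act := ?_, h_eq := ?_ }⟩
  · simp [H.h_zero]
  · intro x y
    rw [H.h_one, f'.2 x, (KNeg f').2 x, mul_inv_rev, KX_mul_comm 0, map_inv]
  · intro n hn x y
    rw [H.h_mul n hn, mul_inv_rev, (K ρ m).comm (n + 1) (by omega)]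
  · intro n hn u x
    rw [H.h_act n hn, f'.2 u, (KNeg f').2 u, map_inv]
  · intro n x
    rcases n with _ | n
    · rw [H.h_zero, Kδ, (KNeg f).2, (KNeg f').2, inv_one, one_mul]; exact (one_mul _).symm
    · change (f.1.map (n + 2) x)⁻¹ = _ * _ * (f'.1.map (n + 2) x)⁻¹
      rw [H.h_eq (n + 1) x, Kδ, Kδ]
      simp only [mul_one, mul_inv_rev]
      rw [KX_mul_comm n]

instance : Zero (Cohomology θ ρ m) := ⟨Quotient.mk _ (KZero θ ρ m)⟩
instance : Add (Cohomology θ ρ m) :=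
  ⟨Quotient.map₂ KAdd (fun _ _ h _ _ h' => KAdd_homotopic h h')⟩
instance : Neg (Cohomology θ ρ m) := ⟨Quotient.map KNeg (fun _ _ h => KNeg_homotopic h)⟩

/-- The abelian group structure on cohomology, by addition of values. -/
instance : AddCommGroup (Cohomology θ ρ m) where
  add_assoc a b c := by
    induction a, b, c using Quotient.inductionOn₃ with | _ a b c =>
    exact congrArg (Quotient.mk _) (KHom_ext fun i x => mul_assoc _ _ _)
  zero_add a := by
    induction a using Quotient.inductionOn with | _ a =>
    exact congrArg (Quotient.mk _) (KHom_ext fun i x => one_mul _)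
  add_zero a := by
    induction a using Quotient.inductionOn with | _ a =>
    exact congrArg (Quotient.mk _) (KHom_ext fun i x => mul_one _)
  neg_add_cancel a := by
    induction a using Quotient.inductionOn with | _ a =>
    exact congrArg (Quotient.mk _) (KHom_ext fun i x => inv_mul_cancel _)
  add_comm a b := by
    induction a, b using Quotient.inductionOn₂ with | _ a b =>
    exact congrArg (Quotient.mk _) (KHom_ext fun i x => KX_mul_comm i _ _)
  nsmul := nsmulRec
  zsmul := zsmulRec

end K

/-! ### The crossed complex `ξC` and its projection to `ζC = K(π₁ C, 1; A, n + 1)` -/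

section xi

variable (C : RedCrossedComplex.{u}) (n : ℕ) (hn : 2 ≤ n)

/-- The groups of `ξC`: an extra direct factor `A` is placed in dimension `n + 1`.  If `Cᵢ` is
trivial for `i > n`, this is `Cᵢ` in dimensions `i ≤ n`, `A` in dimension `n + 1`, and trivial
above. -/
def ξX : ℕ → Type u
  | 0 => C.X 0
  | 1 => C.X 1
  | i + 2 => C.X (i + 2) × sub (C.A n hn) (i + 2 = n + 1)

instance ξX.group : ∀ i, Group (C.ξX n hn i)
  | 0 => inferInstanceAs (Group (C.X 0))
  | 1 => inferInstanceAs (Group (C.X 1))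
  | i + 2 => inferInstanceAs (Group (C.X (i + 2) × sub (C.A n hn) (i + 2 = n + 1)))

/-- The boundaries of `ξC`: those of `C`, together with the inclusion of the factor `A` of
dimension `n + 1` into `Cₙ`. -/
def ξδ : ∀ i, C.ξX n hn (i + 1) →* C.ξX n hn i
  | 0 => C.δ 0
  | 1 => (C.δ 1).comp (MonoidHom.fst (C.X 2) (sub (C.A n hn) (0 + 2 = n + 1)))
  | i + 2 =>
    { toFun := fun (z : C.X (i + 3) × sub (C.A n hn) (i + 3 = n + 1)) =>
        (show C.X (i + 2) × sub (C.A n hn) (i + 2 = n + 1) from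
          (C.δ (i + 2) z.1 * C.inc n hn (i + 2) z.2, 1))
      map_one' := Prod.ext (by
        change C.δ (i + 2) 1 * C.inc n hn (i + 2) 1 = 1
        simp) rfl
      map_mul' := fun z w => Prod.ext (by
        change C.δ (i + 2) (z.1 * w.1) * C.inc n hn (i + 2) (z.2 * w.2) =
          (C.δ (i + 2) z.1 * C.inc n hn (i + 2) z.2) * (C.δ (i + 2) w.1 * C.inc n hn (i + 2) w.2)
        rw [map_mul, map_mul, mul_assoc, mul_assoc, ← mul_assoc (C.δ (i + 2) w.1),
          ← C.inc_central n hn (i + 2) z.2.1, mul_assoc]) (mul_one 1).symm }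

/-- The action of `C₁` on the groups of `ξC`. -/
def ξact : ∀ i, C.X 1 →* MulAut (C.ξX n hn i)
  | 0 => C.act 0
  | 1 => C.act 1
  | i + 2 =>
    { toFun := fun g => (show
          MulAut (C.X (i + 2) × sub (C.A n hn) (i + 2 = n + 1)) from
          MulEquiv.prodCongr (C.act (i + 2) g)
            (restrictAct (C.actA n hn) (sub (C.A n hn) (i + 2 = n + 1))
              (sub_act (C.actA n hn) _) (C.φ g)))
      map_one' := MulEquiv.ext fun z => Prod.ext (by
          change C.act (i + 2) 1 z.1 = z.1
          simp) (Subtype.ext (by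
          change C.actA n hn (C.φ 1) z.2.1 = z.2.1
          simp))
      map_mul' := fun g g' => MulEquiv.ext fun z => Prod.ext (by
          change C.act (i + 2) (g * g') z.1 = C.act (i + 2) g (C.act (i + 2) g' z.1)
          simp) (Subtype.ext (by
          change C.actA n hn (C.φ (g * g')) z.2.1 =
            C.actA n hn (C.φ g) (C.actA n hn (C.φ g') z.2.1)
          simp)) }

theorem φ_δ (x : C.X 2) : C.φ (C.δ 1 x) = 1 := (QuotientGroup.eq_one_iff _).2 ⟨x, rfl⟩

theorem φ_conj (g x : C.X 1) : C.φ (C.act 1 g x) = C.φ g * C.φ x * (C.φ g)⁻¹ := by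
  rw [C.act_conj]; simp

/-- The crossed complex `ξC`. -/
def ξ : RedCrossedComplex.{u} where
  X := C.ξX n hn
  pt := C.pt
  act := C.ξact n hn
  δ := C.ξδ n hn
  act_conj := C.act_conj
  δ_act i := match i with
    | 0 => C.δ_act 0
    | 1 => fun g x => C.δ_act 1 g x.1
    | i + 2 => fun g x => Prod.ext (by
        change C.δ (i + 2) (C.act (i + 3) g x.1) *
            C.inc n hn (i + 2) (C.actA n hn (C.φ g) x.2.1) =
          C.act (i + 2) g (C.δ (i + 2) x.1 * C.inc n hn (i + 2) x.2.1)
        exact (congrArg₂ (· * ·) (C.δ_act _ _ _) (C.inc_act _ _ _ _ _)).trans (map_mul _ _ _).symm) (Subtype.ext (by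
        change 1 = C.actA n hn (C.φ g) 1
        rw [map_one]))
  δ_δ i := match i with
    | 0 => fun x => Subsingleton.elim (α := C.X 0) _ _
    | 1 => fun x => by
        change C.δ 1 (C.δ 2 x.1 * C.inc n hn 2 x.2.1) = 1
        rw [map_mul, C.δ_δ, C.δ_inc, mul_one]
    | i + 2 => fun x => Prod.ext (by
        change C.δ (i + 2) (C.δ (i + 3) x.1 * C.inc n hn (i + 3) x.2.1) *
          C.inc n hn (i + 2) 1 = 1
        rw [map_mul, C.δ_δ, C.δ_inc, mul_one, map_one, mul_one]) rfl
  peiffer x y := Prod.ext (C.peiffer x.1 y.1) (by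
    apply Subtype.ext
    change C.actA n hn (C.φ (C.δ 1 x.1)) y.2.1 = x.2.1 * y.2.1 * x.2.1⁻¹
    rw [φ_δ, map_one, MulAut.one_apply, mul_comm x.2.1, mul_inv_cancel_right])
  comm i hi x y := by
    obtain ⟨i, rfl⟩ : ∃ j, i = j + 2 := ⟨i - 2, by omega⟩
    exact Prod.ext (C.comm (i + 2) hi x.1 y.1) (Subtype.ext (mul_comm x.2.1 y.2.1))
  act_triv i hi x y := by
    obtain ⟨i, rfl⟩ : ∃ j, i = j + 2 := ⟨i - 2, by omega⟩
    refine Prod.ext (C.act_triv (i + 2) hi x.1 y.1) (Subtype.ext ?_)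
    change C.actA n hn (C.φ (C.δ 1 x.1)) y.2.1 = y.2.1
    rw [φ_δ, map_one, MulAut.one_apply]

/-- The projection `p : ξC → ζC = K(π₁ C, 1; A, n + 1)`: the quotient morphism `C₁ → π₁ C` in dimension `1`, the identity
of `A` in dimension `n + 1`, trivial elsewhere. -/
def proj : Hom (C.ξ n hn) (K (C.actA n hn) (n + 1)) where
  map i := match i with
    | 0 => 1
    | 1 => C.φ
    | i + 2 => MonoidHom.snd (C.X (i + 2)) (sub (C.A n hn) (i + 2 = n + 1))
  map_δ i := match i with
    | 0 => fun _ => rfl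
    | 1 => fun x => C.φ_δ x.1
    | i + 2 => fun _ => rfl
  map_act i := match i with
    | 0 => fun _ _ => rfl
    | 1 => fun g x => by
        exact C.φ_conj g x
    | i + 2 => fun _ _ => rfl

end xi

/-! ### The action of `H^n_{θφ}(F, A)` on `[F, C; θφ]` -/

section action

variable {F C : RedCrossedComplex.{u}} {n : ℕ} {hn : 2 ≤ n} {θ : F.π₁ →* C.π₁}

/-- The morphism `K(π₁ C, 1; A, n)ᵢ → Cᵢ`, `i ≥ 2`, given by the inclusion of `A` in `Cₙ`. -/
def Kinc (C : RedCrossedComplex.{u}) (n : ℕ) (hn : 2 ≤ n) (i : ℕ) :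
    (K (C.actA n hn) n).X (i + 2) →* C.X (i + 2) :=
  (C.inc n hn (i + 2)).comp (Kval (C.actA n hn) n i)

theorem Kinc_central (i : ℕ) (a : (K (C.actA n hn) n).X (i + 2)) (x : C.X (i + 2)) :
    Kinc C n hn i a * x = x * Kinc C n hn i a := C.inc_central n hn _ _ _

theorem δ_Kinc (i : ℕ) (a : (K (C.actA n hn) n).X (i + 2)) : C.δ (i + 1) (Kinc C n hn i a) = 1 :=
  C.δ_inc n hn _ _

theorem Kinc_act (i : ℕ) (g : C.X 1) (a : (K (C.actA n hn) n).X (i + 2)) :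
    Kinc C n hn i ((K (C.actA n hn) n).act (i + 2) (KX.ofQ (C.A n hn) n (C.φ g)) a) =
      C.act (i + 2) g (Kinc C n hn i a) := C.inc_act n hn _ g _

/-- The morphism `f` altered by `a`: it is `f` in dimension `1`, and `x ↦ a(x) · f(x)` in
dimensions `≥ 2` (so it differs from `f` only in dimension `n`, where `a` takes values in
`A ⊆ Cₙ`). -/
def translate (a : {f : Hom F (K (C.actA n hn) n) // Over θ (C.actA n hn) n f})
    (f : {f : Hom F C // Realises θ f}) : {f : Hom F C // Realises θ f} :=
  ⟨{ map := fun i => match i with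
      | 0 => f.1.map 0
      | 1 => f.1.map 1
      | i + 2 =>
        { toFun := fun x => Kinc C n hn i (a.1.map (i + 2) x) * f.1.map (i + 2) x
          map_one' := by simp
          map_mul' := fun x y => by
            simp only [map_mul, mul_assoc]
            rw [← mul_assoc (f.1.map (i + 2) x), ← Kinc_central i _ (f.1.map (i + 2) x), mul_assoc] }
     map_δ := fun i => match i with
      | 0 => f.1.map_δ 0
      | 1 => fun x => by
          change f.1.map 1 _ = C.δ 1 (Kinc C n hn 0 _ * f.1.map 2 x)
          rw [map_mul, δ_Kinc, one_mul, f.1.map_δ]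
      | i + 2 => fun x => by
          change Kinc C n hn i _ * f.1.map (i + 2) _ =
            C.δ (i + 2) (Kinc C n hn (i + 1) _ * f.1.map (i + 3) x)
          rw [map_mul, δ_Kinc, one_mul, f.1.map_δ, a.1.map_δ, Kδ, map_one, one_mul]
     map_act := fun i => match i with
      | 0 => f.1.map_act 0
      | 1 => f.1.map_act 1
      | i + 2 => fun g x => by
          change Kinc C n hn i _ * f.1.map (i + 2) _ =
            C.act (i + 2) (f.1.map 1 g) (Kinc C n hn i _ * f.1.map (i + 2) x)
          rw [map_mul, ← Kinc_act, f.1.map_act, a.1.map_act, a.2, f.2] }, f.2⟩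

theorem translate_map_one (a : {f : Hom F (K (C.actA n hn) n) // Over θ (C.actA n hn) n f})
    (f : {f : Hom F C // Realises θ f}) : (translate a f).1.map 1 = f.1.map 1 := rfl

theorem translate_map (a : {f : Hom F (K (C.actA n hn) n) // Over θ (C.actA n hn) n f})
    (f : {f : Hom F C // Realises θ f}) (i : ℕ) (x : F.X (i + 2)) :
    (translate a f).1.map (i + 2) x = Kinc C n hn i (a.1.map (i + 2) x) * f.1.map (i + 2) x := rfl

theorem translate_homotopic_right
    (a : {f : Hom F (K (C.actA n hn) n) // Over θ (C.actA n hn) n f})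
    {f g : {f : Hom F C // Realises θ f}} (h : Homotopic f.1 g.1) :
    Homotopic (translate a f).1 (translate a g).1 := by
  obtain ⟨H⟩ := h
  refine ⟨{ h := H.h, h_zero := H.h_zero, h_one := H.h_one, h_mul := H.h_mul, h_act := H.h_act,
            h_eq := ?_ }⟩
  intro i x
  rcases i with _ | i
  · exact H.h_eq 0 x
  · rw [translate_map, translate_map, H.h_eq (i + 1) x, ← mul_assoc, Kinc_central i, mul_assoc]

theorem translate_homotopic_left
    {a b : {f : Hom F (K (C.actA n hn) n) // Over θ (C.actA n hn) n f}}
    (f : {f : Hom F C // Realises θ f}) (h : Homotopic a.1 b.1) :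
    Homotopic (translate a f).1 (translate b f).1 := by
  obtain ⟨H⟩ := h
  refine ⟨{ h := fun i => match i with
              | 0 => fun _ => 1
              | i + 1 => fun x => Kinc C n hn i (H.h (i + 1) x)
            h_zero := fun _ => rfl, h_one := ?_, h_mul := ?_, h_act := ?_, h_eq := ?_ }⟩
  · intro x y
    change Kinc C n hn 0 _ = Kinc C n hn 0 _ * C.act 2 (f.1.map 1 x) (Kinc C n hn 0 _)
    rw [H.h_one, map_mul, ← Kinc_act, b.2, f.2]
  · intro i hi x y
    obtain ⟨i, rfl⟩ : ∃ j, i = j + 1 := ⟨i - 1, by omega⟩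
    change Kinc C n hn i _ = Kinc C n hn i _ * Kinc C n hn i _
    rw [H.h_mul _ hi, map_mul]
  · intro i hi u x
    obtain ⟨i, rfl⟩ : ∃ j, i = j + 1 := ⟨i - 1, by omega⟩
    change Kinc C n hn i _ = C.act (i + 2) (f.1.map 1 u) (Kinc C n hn i _)
    rw [H.h_act _ hi, ← Kinc_act, b.2, f.2]
  · intro i x
    rcases i with _ | i
    · change f.1.map 1 x = 1 * C.δ 1 (Kinc C n hn 0 _) * f.1.map 1 x
      rw [δ_Kinc, one_mul, one_mul]
    · change Kinc C n hn i _ * f.1.map (i + 2) x = Kinc C n hn i _ *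
        C.δ (i + 2) (Kinc C n hn (i + 1) _) * (Kinc C n hn i _ * f.1.map (i + 2) x)
      rw [δ_Kinc, mul_one, ← mul_assoc, ← map_mul, H.h_eq (i + 1) x, Kδ, mul_one]

/-- The action of `H^n_{θφ}(F, A)` on `[F, C; θφ]`: `[a] + [f]` is the class of `translate a f`. -/
instance : AddAction (Cohomology θ (C.actA n hn) n) (Classes F C θ) where
  vadd := Quotient.map₂ translate fun _ _ h _ g h' =>
    (translate_homotopic_left _ h).trans (translate_homotopic_right _ h')
  zero_vadd x := by
    induction x using Quotient.inductionOn with | _ f =>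
    refine congrArg (Quotient.mk _) (Subtype.ext (Hom.ext (funext fun i => ?_)))
    match i with
    | 0 => rfl
    | 1 => rfl
    | i + 2 =>
      ext x
      rw [translate_map]
      change Kinc C n hn i 1 * _ = _
      rw [map_one, one_mul]
  add_vadd a b x := by
    induction a, b, x using Quotient.inductionOn₃ with | _ a b f =>
    refine congrArg (Quotient.mk _) (Subtype.ext (Hom.ext (funext fun i => ?_)))
    match i with
    | 0 => rfl
    | 1 => rfl
    | i + 2 =>
      ext x
      rw [translate_map, translate_map, translate_map, ← mul_assoc, ← map_mul]
      rfl

end action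

/-- `k` is the obstruction class of `θ`: there are morphisms `f' : F → ξC` realising `θ` (that is,
`p ∘ f'` is `θφ` in dimension `1`), and `k` is the class of `p ∘ f'` for every such `f'`. -/
def IsObstruction {F C : RedCrossedComplex.{u}} (n : ℕ) (hn : 2 ≤ n) (θ : F.π₁ →* C.π₁)
    (k : Cohomology θ (C.actA n hn) (n + 1)) : Prop :=
  (∃ f' : Hom F (C.ξ n hn), Over θ (C.actA n hn) (n + 1) ((C.proj n hn).comp f')) ∧
  ∀ (f' : Hom F (C.ξ n hn)) (h : Over θ (C.actA n hn) (n + 1) ((C.proj n hn).comp f')),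
    (Quotient.mk _ ⟨(C.proj n hn).comp f', h⟩ : Cohomology θ (C.actA n hn) (n + 1)) = k

end RedCrossedComplex

/-!
The theorem is obstruction theory for crossed complexes. The complex `ξC` is `C` with `A = ker δₙ`
glued on in dimension `n + 1`, which kills the only homology group of `C` in dimensions `≥ 2` that
may be non-trivial; so `ξC` is acyclic (`ξ_isAcyclic`). Into an acyclic complex, a free crossed
complex `F` maps as a projective resolution does: homomorphisms of fundamental groups are realised
(`IsFree.exists_hom`), two realisations are homotopic (`IsFree.homotopic`), and a self-homotopy is
null up to a homotopy of the next degree (`IsFree.homotopy_null`). The first two facts give the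
obstruction class.

Everything else is reading off the `A`-component in `ξC`:

* a null-homotopy of `p ∘ f'` is a family of elements of `A ⊆ Cₙ` by which `f'` can be divided to
  land in `C` (`exists_realises_of_homotopic_zero`);
* a homotopy in `ξC` between two morphisms to `C` has as `A`-component an `n`-cocycle, and the
  rest of it is a homotopy in `C` after translation by that cocycle
  (`exists_translate_homotopic`), so the action is transitive;
* a homotopy in `C` from `a + f` to `f`, completed by `-a`, is a self-homotopy of `f` in `ξC`
  (`selfHomotopy`); the `A`-component of its nullity bounds `a`
  (`eq_zero_of_translate_homotopic`), so the action is free.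

The comparison results rest on lifting out of free groups by derivations
(`exists_lift_derivation`), out of free crossed modules (`IsFreeCrossedModuleOn.exists_lift`) and
out of free `ℤ[π₁ F]`-modules (`IsFree.exists_lift_three`). In the last two cases one forms the
pullback of the homomorphism to be lifted, which is again a crossed module, respectively a module,
and projects onto `Fₙ`; a section of this projection is a lift.
-/

namespace RedCrossedComplex

/-! ### Lifting along free groups, free crossed modules and free modules -/

/-- A derivation on a free group lifts along every equivariant homomorphism whose range contains its
values: in terms of semidirect products, a derivation `G → N` is a homomorphism
`G → N ⋊ G` over `G`, which lifts to `M ⋊ G` by freeness. -/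
theorem exists_lift_derivation {G M N : Type*} [Group G] [IsFreeGroup G] [Group M] [Group N]
    (α : G →* MulAut M) (β : G →* MulAut N) (p : M →* N)
    (hp : ∀ g m, p (α g m) = β g (p m)) (d : G → N)
    (hd : ∀ x y, d (x * y) = d x * β x (d y)) (hr : ∀ x, d x ∈ p.range) :
    ∃ e : G → M, (∀ x y, e (x * y) = e x * α x (e y)) ∧ ∀ x, p (e x) = d x := by
  choose m hm using hr
  let E : G →* M ⋊[α] G := IsFreeGroup.lift fun a => ⟨m (IsFreeGroup.of a), IsFreeGroup.of a⟩
  have hE : ∀ a, E (IsFreeGroup.of a) = ⟨m (IsFreeGroup.of a), IsFreeGroup.of a⟩ :=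
    fun a => IsFreeGroup.lift_of _ a
  have h2 : ∀ x, (E x).right = x := fun x =>
    DFunLike.congr_fun (IsFreeGroup.ext_hom (f := SemidirectProduct.rightHom.comp E)
      (g := MonoidHom.id G) fun a => by simp [hE]) x
  let P : M ⋊[α] G →* N ⋊[β] G := SemidirectProduct.map p (MonoidHom.id G) fun g =>
    MonoidHom.ext fun x => hp g x
  let d' : G →* N ⋊[β] G := MonoidHom.mk' (fun x => ⟨d x, x⟩) fun x y =>
    SemidirectProduct.ext (hd x y) rfl
  have h3 : P.comp E = d' := IsFreeGroup.ext_hom fun a => by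
    rw [MonoidHom.comp_apply, hE]
    exact SemidirectProduct.ext (hm _) rfl
  refine ⟨fun x => (E x).left, fun x y => ?_, fun x => ?_⟩
  · change (E (x * y)).left = (E x).left * α x (E y).left
    rw [map_mul, SemidirectProduct.mul_left, h2]
  · exact congrArg SemidirectProduct.left (DFunLike.congr_fun h3 x)

/-- The diagonal action on a product of groups. -/
def diagAct {G M N : Type*} [Group G] [Group M] [Group N] (α : G →* MulAut M)
    (β : G →* MulAut N) : G →* MulAut (M × N) where
  toFun g := MulEquiv.prodCongr (α g) (β g)
  map_one' := MulEquiv.ext fun z => by simp [MulEquiv.prodCongr]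
  map_mul' g g' := MulEquiv.ext fun z => by simp [MulEquiv.prodCongr, Prod.map]

variable {F : RedCrossedComplex.{u}}

/-- Lifting out of a free crossed module: an equivariant homomorphism `d` on `F₂` lifts along an
equivariant homomorphism `p : M → N` whose range contains the values of `d`, as soon as the
pullback of `p` and `d` satisfies the Peiffer identity, i.e. is a crossed module over `F₁`. -/
theorem IsFreeCrossedModuleOn.exists_lift {B : Type u} {b : B → F.X 2}
    (hb : F.IsFreeCrossedModuleOn b) {M N : Type u} [Group M] [Group N]
    (α : F.X 1 →* MulAut M) (β : F.X 1 →* MulAut N) (p : M →* N)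
    (hp : ∀ g m, p (α g m) = β g (p m)) (d : F.X 2 →* N)
    (hd : ∀ g x, d (F.act 2 g x) = β g (d x)) (hr : ∀ x, d x ∈ p.range)
    (peiffer : ∀ x m m', p m = d x → α (F.δ 1 x) m' = m * m' * m⁻¹) :
    ∃ e : F.X 2 →* M, (∀ g x, e (F.act 2 g x) = α g (e x)) ∧ ∀ x, p (e x) = d x := by
  choose s hs using hr
  let γ : F.X 1 →* MulAut (M × F.X 2) := diagAct α (F.act 2)
  let S : Subgroup (M × F.X 2) :=
    (p.comp (MonoidHom.fst M (F.X 2))).eqLocus (d.comp (MonoidHom.snd M (F.X 2)))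
  have hS : ∀ g, ∀ z ∈ S, γ g z ∈ S := fun g z (hz : p z.1 = d z.2) => by
    change p (α g z.1) = d (F.act 2 g z.2)
    rw [hp, hd, hz]
  let q : S →* F.X 2 := (MonoidHom.snd M (F.X 2)).comp S.subtype
  obtain ⟨ψ, ⟨h1, h2, h3⟩, -⟩ := hb S (restrictAct γ S hS) ((F.δ 1).comp q)
    (fun g z => by
      change F.δ 1 (F.act 2 g z.1.2) = g * F.δ 1 z.1.2 * g⁻¹
      rw [F.δ_act, F.act_conj])
    (fun z w => Subtype.ext (Prod.ext (peiffer z.1.2 z.1.1 w.1.1 z.2) (F.peiffer z.1.2 w.1.2)))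
    (fun x => ⟨(s (b x), b x), hs (b x)⟩) (fun x => rfl)
  have hq1 : ∀ g x, q (ψ (F.act 2 g x)) = F.act 2 g (q (ψ x)) := fun g x => by rw [h1]; rfl
  have hq : q.comp ψ = MonoidHom.id _ := by
    obtain ⟨k, -, hk⟩ := hb (F.X 2) (F.act 2) (F.δ 1)
      (fun g x => by rw [F.δ_act, F.act_conj]) F.peiffer b (fun x => rfl)
    refine (hk (q.comp ψ) ⟨hq1, h2, fun x => ?_⟩).trans
      (hk (MonoidHom.id _) ⟨fun _ _ => rfl, fun _ => rfl, fun _ => rfl⟩).symm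
    exact congrArg q (h3 x)
  refine ⟨((MonoidHom.fst M (F.X 2)).comp S.subtype).comp ψ, fun g x => ?_, fun x => ?_⟩
  · change (ψ (F.act 2 g x)).1.1 = α g (ψ x).1.1
    rw [h1]; rfl
  · exact (ψ x).2.trans (congrArg d (DFunLike.congr_fun hq x))

/-- A `G`-action by automorphisms on an abelian group, as an integral representation of `G`. -/
def toRep {G E : Type*} [Group G] [CommGroup E] (ρ : G →* MulAut E) :
    Representation ℤ G (Additive E) where
  toFun g := (MonoidHom.toAdditive (ρ g).toMonoidHom).toIntLinearMap
  map_one' := by ext x; simp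
  map_mul' g g' := by ext x; simp

/-- An equivariant surjection of abelian groups with operators onto a projective `ℤ[G]`-module has
an equivariant section. -/
theorem exists_equivariant_section {G E P : Type*} [Group G] [CommGroup E] [CommGroup P]
    (σ : G →* MulAut E) (ρ : G →* MulAut P)
    [Module.Projective (MonoidAlgebra ℤ G) (toRep ρ).asModule]
    (q : E →* P) (hq : ∀ g x, q (σ g x) = ρ g (q x)) (hs : Function.Surjective q) :
    ∃ s : P →* E, (∀ g x, s (ρ g x) = σ g (s x)) ∧ ∀ x, q (s x) = x := by
  let q' : (toRep σ).IntertwiningMap (toRep ρ) :=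
    { toLinearMap := (MonoidHom.toAdditive q).toIntLinearMap
      isIntertwining' := fun g => LinearMap.ext fun x => hq g x }
  let eqv := Representation.IntertwiningMap.equivLinearMapAsModule (toRep σ) (toRep ρ)
  let eqv' := Representation.IntertwiningMap.equivLinearMapAsModule (toRep ρ) (toRep σ)
  obtain ⟨t, ht⟩ := Module.projective_lifting_property (eqv q') LinearMap.id hs
  let t' := eqv'.symm t
  exact ⟨MonoidHom.toAdditive.symm (t'.toLinearMap.toAddMonoidHom),
    fun g x => LinearMap.congr_fun (t'.isIntertwining' g) x, fun x => LinearMap.congr_fun ht x⟩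

/-- Lifting out of the free `ℤ[π₁ F]`-modules `Fₙ`, `n ≥ 3`. -/
theorem IsFree.exists_lift_three (hF : F.IsFree) (i : ℕ) {M N : Type u} [Group M] [Group N]
    (comm : ∀ m m' : M, m * m' = m' * m) (α : F.X 1 →* MulAut M) (β : F.X 1 →* MulAut N)
    (triv : ∀ x m, α (F.δ 1 x) m = m) (p : M →* N) (hp : ∀ g m, p (α g m) = β g (p m))
    (d : F.X (i + 3) →* N) (hd : ∀ g x, d (F.act (i + 3) g x) = β g (d x))
    (hr : ∀ x, d x ∈ p.range) :
    ∃ e : F.X (i + 3) →* M,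
      (∀ g x, e (F.act (i + 3) g x) = α g (e x)) ∧ ∀ x, p (e x) = d x := by
  let S : Subgroup (M × F.X (i + 3)) :=
    (p.comp (MonoidHom.fst M (F.X (i + 3)))).eqLocus (d.comp (MonoidHom.snd M (F.X (i + 3))))
  let _ : CommGroup S :=
    { S.toGroup with
      mul_comm := fun z w => Subtype.ext (Prod.ext (comm _ _) (F.comm (i + 3) (by omega) _ _)) }
  let γ : F.X 1 →* MulAut (M × F.X (i + 3)) := diagAct α (F.act (i + 3))
  have hS : ∀ g, ∀ z ∈ S, γ g z ∈ S := fun g z (hz : p z.1 = d z.2) => by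
    change p (α g z.1) = d (F.act (i + 3) g z.2)
    rw [hp, hd, hz]
  let σ : F.π₁ →* MulAut S := QuotientGroup.lift (F.δ 1).range (restrictAct γ S hS) (by
    rintro _ ⟨x, rfl⟩
    exact MulEquiv.ext fun z => Subtype.ext
      (Prod.ext (triv x z.1.1) (F.act_triv (i + 3) (by omega) x z.1.2)))
  have : Module.Free (MonoidAlgebra ℤ F.π₁) (toRep (F.actπ i)).asModule := hF.three i
  obtain ⟨s, h1, h2⟩ := exists_equivariant_section σ (F.actπ i)
    ((MonoidHom.snd M (F.X (i + 3))).comp S.subtype)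
    (fun g => QuotientGroup.induction_on g fun g z => rfl)
    (fun x => (hr x).elim fun m hm => ⟨⟨(m, x), hm⟩, rfl⟩)
  refine ⟨((MonoidHom.fst M (F.X (i + 3))).comp S.subtype).comp s, fun g x => ?_, fun x => ?_⟩
  · exact congrArg (fun z : S => z.1.1) (h1 (F.φ g) x)
  · exact (s x).2.trans (congrArg d (h2 x))

/-- Lifting out of `Fₙ`, `n ≥ 2`, along a homomorphism from an abelian group with operators in
`π₁ F`. -/
theorem IsFree.exists_lift (hF : F.IsFree) (i : ℕ) {M N : Type u} [Group M] [Group N]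
    (comm : ∀ m m' : M, m * m' = m' * m) (α : F.X 1 →* MulAut M) (β : F.X 1 →* MulAut N)
    (triv : ∀ x m, α (F.δ 1 x) m = m) (p : M →* N) (hp : ∀ g m, p (α g m) = β g (p m))
    (d : F.X (i + 2) →* N) (hd : ∀ g x, d (F.act (i + 2) g x) = β g (d x))
    (hr : ∀ x, d x ∈ p.range) :
    ∃ e : F.X (i + 2) →* M,
      (∀ g x, e (F.act (i + 2) g x) = α g (e x)) ∧ ∀ x, p (e x) = d x := by
  rcases i with _ | i
  · obtain ⟨B, b, hb⟩ := hF.two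
    exact hb.exists_lift α β p hp d hd hr fun x m m' _ => by
      rw [triv, comm m m', mul_inv_cancel_right]
  · exact hF.exists_lift_three i comm α β triv p hp d hd hr

/-- The inductive construction of operator morphisms `tᵢ : Fᵢ₊₂ → Tᵢ` into a sequence of groups with
operators: the boundary of `tᵢ₊₁` is prescribed as a function `ob` of `tᵢ`, which takes values in
boundaries at each stage by virtue of the preceding one. -/
theorem IsFree.exists_seq (hF : F.IsFree) {T : ℕ → Type u} [∀ i, Group (T i)]
    (α : ∀ i, F.X 1 →* MulAut (T i)) (D : ∀ i, T (i + 1) →* T i)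
    (hα : ∀ i g x, D i (α (i + 1) g x) = α i g (D i x))
    (comm : ∀ i (x y : T (i + 1)), x * y = y * x)
    (triv : ∀ i x (y : T (i + 1)), α (i + 1) (F.δ 1 x) y = y)
    (ob : ∀ i, (F.X (i + 2) →* T i) → F.X (i + 3) →* T i)
    (hob : ∀ i t, (∀ g x, t (F.act (i + 2) g x) = α i g (t x)) →
      ∀ g x, ob i t (F.act (i + 3) g x) = α i g (ob i t x))
    (t₀ : F.X 2 →* T 0) (ht₀ : ∀ g x, t₀ (F.act 2 g x) = α 0 g (t₀ x))
    (h₀ : ∀ x, ob 0 t₀ x ∈ (D 0).range)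
    (hs : ∀ i t t', (∀ x, D i (t' x) = ob i t x) → ∀ x, ob (i + 1) t' x ∈ (D (i + 1)).range) :
    ∃ t : ∀ i, F.X (i + 2) →* T i, t 0 = t₀ ∧
      (∀ i g x, t i (F.act (i + 2) g x) = α i g (t i x)) ∧
      ∀ i x, D i (t (i + 1) x) = ob i (t i) x := by
  let St (i : ℕ) : Type u := {t : F.X (i + 2) →* T i //
    (∀ g x, t (F.act (i + 2) g x) = α i g (t x)) ∧ ∀ x, ob i t x ∈ (D i).range}
  have step : ∀ i (t : St i), ∃ t' : St (i + 1), ∀ x, D i (t'.1 x) = ob i t.1 x := by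
    intro i t
    obtain ⟨e, h1, h2⟩ := hF.exists_lift (i + 1) (comm i) (α (i + 1)) (α i) (triv i) (D i) (hα i)
      (ob i t.1) (hob i t.1 t.2.1) t.2.2
    exact ⟨⟨e, h1, hs i t.1 e h2⟩, h2⟩
  choose next hnext using step
  let t : ∀ i, St i := fun i => Nat.rec ⟨t₀, ht₀, h₀⟩ next i
  exact ⟨fun i => (t i).1, rfl, fun i => (t i).2.1, fun i => hnext i (t i)⟩

variable {D : RedCrossedComplex.{u}}

/-! ### Comparison with complexes without higher homology -/

/-- `Hᵢ(D) = 0` for all `i ≥ 2`. -/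
def IsAcyclic (D : RedCrossedComplex.{u}) : Prop :=
  ∀ i (x : D.X (i + 2)), D.δ (i + 1) x = 1 → x ∈ (D.δ (i + 2)).range

/-- The action of `F₁` on `Dₙ` through a homomorphism `F₁ → D₁`. -/
def actVia (t : F.X 1 →* D.X 1) (n : ℕ) : F.X 1 →* MulAut (D.X n) := (D.act n).comp t

theorem actVia_apply (t : F.X 1 →* D.X 1) (n : ℕ) (g : F.X 1) (x : D.X n) :
    actVia t n g x = D.act n (t g) x := rfl

theorem Hom.actVia_δ (f : Hom F D) (n : ℕ) (hn : 3 ≤ n) (x : F.X 2) (y : D.X n) :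
    actVia (f.map 1) n (F.δ 1 x) y = y := by
  rw [actVia_apply, f.map_δ, D.act_triv n hn]

/-- A homomorphism on fundamental groups is realised by a morphism from a free crossed complex to
an acyclic one. The fundamental group of the target is given as a quotient `q : D₁ → Q`. -/
theorem IsFree.exists_hom (hF : F.IsFree) (hD : D.IsAcyclic) {Q : Type u} [Group Q]
    (q : D.X 1 →* Q) (hq : Function.Surjective q) (hker : ∀ u, q u = 1 ↔ u ∈ (D.δ 1).range)
    (θ : F.π₁ →* Q) : ∃ f : Hom F D, ∀ x, q (f.map 1 x) = θ (F.φ x) := by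
  have := hF.one
  choose s hs using hq
  let f₁ : F.X 1 →* D.X 1 := IsFreeGroup.lift fun a => s (θ (F.φ (IsFreeGroup.of a)))
  have hf₁ : ∀ x, q (f₁ x) = θ (F.φ x) := fun x =>
    DFunLike.congr_fun (IsFreeGroup.ext_hom (f := q.comp f₁) (g := θ.comp F.φ) fun a => by
      simp [f₁, hs]) x
  obtain ⟨B, b, hb⟩ := hF.two
  obtain ⟨f₂, h2, h2'⟩ := hb.exists_lift (actVia f₁ 2) (actVia f₁ 1) (D.δ 1)
    (fun g m => D.δ_act 1 _ m) (f₁.comp (F.δ 1))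
    (fun g x => by
      simp only [MonoidHom.comp_apply, actVia_apply, F.δ_act, F.act_conj, D.act_conj, map_mul,
        map_inv])
    (fun x => (hker _).1 (by rw [MonoidHom.comp_apply, hf₁, φ_δ, map_one]))
    (fun x m m' h => by
      have h' : D.δ 1 m = f₁ (F.δ 1 x) := h
      rw [actVia_apply, ← h', D.peiffer])
  obtain ⟨t, rfl, ht, htδ⟩ := hF.exists_seq (T := fun i => D.X (i + 2))
    (fun i => actVia f₁ (i + 2)) (fun i => D.δ (i + 2)) (fun i g x => D.δ_act (i + 2) _ x)
    (fun i => D.comm (i + 3) (by omega))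
    (fun i x y => by
      have : f₁ (F.δ 1 x) = D.δ 1 (f₂ x) := (h2' x).symm
      rw [actVia_apply, this, D.act_triv (i + 1 + 2) (by omega)])
    (fun i t => t.comp (F.δ (i + 2)))
    (fun i t ht g x => by
      simp only [MonoidHom.comp_apply]
      rw [F.δ_act, ht])
    f₂ h2
    (fun x => hD 0 _ (by
      refine (h2' _).trans ?_
      simp only [MonoidHom.comp_apply]
      rw [F.δ_δ, map_one]))
    (fun i t t' h x => hD (i + 1) _ (by
      refine (h _).trans ?_
      simp only [MonoidHom.comp_apply]
      rw [F.δ_δ, map_one]))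
  refine ⟨{ map := fun n => match n with
              | 0 => 1
              | 1 => f₁
              | i + 2 => t i
            map_δ := fun n => match n with
              | 0 => fun x => Subsingleton.elim _ _
              | 1 => fun x => (h2' x).symm
              | i + 2 => fun x => (htδ i x).symm
            map_act := fun n => match n with
              | 0 => fun g x => Subsingleton.elim _ _
              | 1 => fun g x => by
                change f₁ _ = D.act 1 (f₁ g) (f₁ x)
                rw [F.act_conj, D.act_conj, map_mul, map_mul, map_inv]
              | i + 2 => ht i }, hf₁⟩

/-- Assembly of the components of a homotopy. -/
theorem Homotopic.of_components {f g : Hom F D} (h₁ : F.X 1 → D.X 2)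
    (h : ∀ i, F.X (i + 2) →* D.X (i + 3))
    (h_one : ∀ x y, h₁ (x * y) = h₁ x * actVia (g.map 1) 2 x (h₁ y))
    (h_act : ∀ i u x, h i (F.act (i + 2) u x) = actVia (g.map 1) (i + 3) u (h i x))
    (h_eq₀ : ∀ x, f.map 1 x = D.δ 1 (h₁ x) * g.map 1 x)
    (h_eq₁ : ∀ x, f.map 2 x = h₁ (F.δ 1 x) * D.δ 2 (h 0 x) * g.map 2 x)
    (h_eq : ∀ i x, f.map (i + 3) x =
      h i (F.δ (i + 2) x) * D.δ (i + 3) (h (i + 1) x) * g.map (i + 3) x) : Homotopic f g :=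
  ⟨{ h := fun n => match n with
      | 0 => fun _ => 1
      | 1 => h₁
      | i + 2 => h i
     h_zero := fun _ => rfl
     h_one := h_one
     h_mul := fun n hn => by
       obtain ⟨i, rfl⟩ : ∃ i, n = i + 2 := ⟨n - 2, by omega⟩
       exact map_mul (h i)
     h_act := fun n hn => by
       obtain ⟨i, rfl⟩ : ∃ i, n = i + 2 := ⟨n - 2, by omega⟩
       exact h_act i
     h_eq := fun n => match n with
      | 0 => fun x => by rw [one_mul]; exact h_eq₀ x
      | 1 => h_eq₁
      | i + 2 => h_eq i }⟩

/-- Multiplicativity of `x ↦ h(x)⁻¹ f(x) g(x)⁻¹` for homomorphisms `f`, `g` and an `h` with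
`h(xy) = h(x) · g(x) h(y) g(x)⁻¹`, provided that its values are central. -/
theorem twisted_mul {G : Type*} [Group G] (hx hy fx fy gx gy : G)
    (ha : ∀ z, hx⁻¹ * fx * gx⁻¹ * z = z * (hx⁻¹ * fx * gx⁻¹))
    (hb : ∀ z, hy⁻¹ * fy * gy⁻¹ * z = z * (hy⁻¹ * fy * gy⁻¹)) :
    (hx * (gx * hy * gx⁻¹))⁻¹ * (fx * fy) * (gx * gy)⁻¹ =
      hx⁻¹ * fx * gx⁻¹ * (hy⁻¹ * fy * gy⁻¹) := by
  obtain ⟨a, rfl⟩ : ∃ a, fx = hx * a * gx := ⟨hx⁻¹ * fx * gx⁻¹, by group⟩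
  obtain ⟨b, rfl⟩ : ∃ b, fy = hy * b * gy := ⟨hy⁻¹ * fy * gy⁻¹, by group⟩
  simp only [mul_assoc, mul_inv_rev, inv_mul_cancel_left, mul_inv_cancel, mul_one, inv_inv,
    mul_inv_cancel_left] at ha hb ⊢
  rw [hb gx⁻¹, ha (gx * (hy * (gx⁻¹ * b))), ha b]
  group

/-- The computation behind the equivariance of `x ↦ h(x)⁻¹ f(x) g(x)⁻¹`: `k` is the value on the
acting element of the derivation by which the actions through `f` and `g` differ. -/
theorem twisted_conj {G : Type*} [Group G] (k h f w : G)
    (hc : ∀ z, h⁻¹ * f * w⁻¹ * z = z * (h⁻¹ * f * w⁻¹)) :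
    (k * h * (w * k⁻¹ * w⁻¹))⁻¹ * (k * f * k⁻¹) * w⁻¹ = h⁻¹ * f * w⁻¹ := by
  obtain ⟨c, rfl⟩ : ∃ c, f = h * c * w := ⟨h⁻¹ * f * w⁻¹, by group⟩
  simp only [mul_assoc, mul_inv_rev, inv_mul_cancel_left, mul_inv_cancel, mul_one, inv_inv] at hc ⊢
  rw [hc (w * (k⁻¹ * w⁻¹))]
  group

/-- Two morphisms from a free crossed complex to an acyclic one which agree on fundamental groups
are homotopic. -/
theorem IsFree.homotopic (hF : F.IsFree) (hD : D.IsAcyclic) (f g : Hom F D)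
    (hfg : ∀ x, f.map 1 x * (g.map 1 x)⁻¹ ∈ (D.δ 1).range) : Homotopic f g := by
  have := hF.one
  -- the difference of `f` and `g` in dimension `1` is a derivation over `g`
  obtain ⟨h₁, h1, h1'⟩ := exists_lift_derivation (actVia (g.map 1) 2) (actVia (g.map 1) 1) (D.δ 1)
    (fun u m => D.δ_act 1 _ m) (fun x => f.map 1 x * (g.map 1 x)⁻¹)
    (fun x y => by
      rw [actVia_apply, D.act_conj, map_mul, map_mul]
      group) hfg
  -- the defect in dimension `2`, which `h₂` has to bound, is a cycle and hence central
  have hd : ∀ x, D.δ 1 ((h₁ (F.δ 1 x))⁻¹ * f.map 2 x * (g.map 2 x)⁻¹) = 1 := fun x => by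
    rw [map_mul, map_mul, map_inv, map_inv, h1', ← f.map_δ, ← g.map_δ]
    group
  have h₁_one : h₁ 1 = 1 := by simpa using h1 1 1
  let d : F.X 2 →* D.X 2 := MonoidHom.mk' (fun x => (h₁ (F.δ 1 x))⁻¹ * f.map 2 x * (g.map 2 x)⁻¹)
    fun x y => by
      rw [map_mul (F.δ 1), h1, actVia_apply, g.map_δ, D.peiffer, map_mul, map_mul]
      exact twisted_mul _ _ _ _ _ _ (D.cyc_central 2 le_rfl _ (hd x))
        (D.cyc_central 2 le_rfl _ (hd y))
  obtain ⟨h₂, h2, h2'⟩ := hF.exists_lift 0 (D.comm 3 le_rfl) (actVia (g.map 1) 3)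
    (actVia (g.map 1) 2) (g.actVia_δ 3 le_rfl) (D.δ 2) (fun u m => D.δ_act 2 _ m) d
    (fun u x => by
      have hc : D.act 2 (g.map 1 u) ((h₁ (F.δ 1 x))⁻¹ * f.map 2 x * (g.map 2 x)⁻¹) ∈ D.cyc 2 :=
        D.cyc_act 2 _ _ (hd x)
      have hi : D.act 2 (g.map 1 u) (h₁ u⁻¹) = (h₁ u)⁻¹ := by
        have := h1 u u⁻¹
        rw [mul_inv_cancel, h₁_one, actVia_apply] at this
        exact (inv_eq_of_mul_eq_one_right this.symm).symm
      have hu : f.map 1 u = D.δ 1 (h₁ u) * g.map 1 u := by rw [h1', inv_mul_cancel_right]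
      change (h₁ (F.δ 1 (F.act 2 u x)))⁻¹ * f.map 2 (F.act 2 u x) * (g.map 2 (F.act 2 u x))⁻¹ =
        D.act 2 (g.map 1 u) ((h₁ (F.δ 1 x))⁻¹ * f.map 2 x * (g.map 2 x)⁻¹)
      have hg : D.act 2 (g.map 1 (F.δ 1 x)) (h₁ u⁻¹) = g.map 2 x * h₁ u⁻¹ * (g.map 2 x)⁻¹ := by
        rw [g.map_δ, D.peiffer]
      rw [F.δ_act, F.act_conj, h1, h1, f.map_act, g.map_act, hu]
      simp only [actVia_apply, map_mul, MulAut.mul_apply, D.peiffer, map_inv] at hc hg ⊢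
      rw [hg, map_mul, map_mul, map_inv, hi]
      exact twisted_conj _ _ _ _ (D.cyc_central 2 le_rfl _ hc))
    (fun x => hD 0 _ (hd x))
  obtain ⟨h, rfl, ht, hδ⟩ := hF.exists_seq (T := fun i => D.X (i + 3))
    (fun i => actVia (g.map 1) (i + 3)) (fun i => D.δ (i + 3)) (fun i u x => D.δ_act (i + 3) _ x)
    (fun i => D.comm (i + 4) (by omega)) (fun i => g.actVia_δ (i + 4) (by omega))
    (fun i t => (t.comp (F.δ (i + 2)))⁻¹ * f.map (i + 3) * (g.map (i + 3))⁻¹)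
    (fun i t ht u x => by
      have hu : f.map 1 u = D.δ 1 (h₁ u) * g.map 1 u := by rw [h1', inv_mul_cancel_right]
      have hf : f.map (i + 3) (F.act (i + 3) u x) =
          actVia (g.map 1) (i + 3) u (f.map (i + 3) x) := by
        rw [f.map_act, hu, map_mul, MulAut.mul_apply, D.act_triv (i + 3) (by omega), actVia_apply]
      change (t (F.δ (i + 2) (F.act (i + 3) u x)))⁻¹ * f.map (i + 3) (F.act (i + 3) u x) *
        (g.map (i + 3) (F.act (i + 3) u x))⁻¹ = actVia (g.map 1) (i + 3) u
          ((t (F.δ (i + 2) x))⁻¹ * f.map (i + 3) x * (g.map (i + 3) x)⁻¹)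
      rw [F.δ_act, ht, hf, g.map_act, map_mul, map_mul, map_inv, map_inv]
      rfl)
    h₂ h2
    (fun x => hD 1 _ (by
      change D.δ 2 ((h₂ (F.δ 2 x))⁻¹ * f.map 3 x * (g.map 3 x)⁻¹) = 1
      rw [map_mul, map_mul, map_inv, map_inv, h2', ← f.map_δ, ← g.map_δ]
      change ((h₁ (F.δ 1 (F.δ 2 x)))⁻¹ * _ * _)⁻¹ * _ * _ = (1 : D.X 2)
      rw [F.δ_δ, h₁_one]
      group))
    (fun i t t' h x => hD (i + 2) _ (by
      have ht' : D.δ (i + 3) (t' (F.δ (i + 3) x)) = (t (F.δ (i + 2) (F.δ (i + 3) x)))⁻¹ *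
        f.map (i + 3) (F.δ (i + 3) x) * (g.map (i + 3) (F.δ (i + 3) x))⁻¹ := h _
      change D.δ (i + 3) ((t' (F.δ (i + 3) x))⁻¹ * f.map (i + 4) x * (g.map (i + 4) x)⁻¹) = 1
      rw [map_mul, map_mul, map_inv, map_inv, ht', ← f.map_δ, ← g.map_δ, F.δ_δ, map_one]
      group))
  refine Homotopic.of_components h₁ h h1 ht (fun x => ?_) (fun x => ?_) (fun i x => ?_)
  · rw [h1', inv_mul_cancel_right]
  · rw [h2']
    change _ = _ * ((h₁ (F.δ 1 x))⁻¹ * f.map 2 x * (g.map 2 x)⁻¹) * _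
    group
  · rw [hδ]
    change _ = _ * ((h i (F.δ (i + 2) x))⁻¹ * f.map (i + 3) x * (g.map (i + 3) x)⁻¹) * _
    group

/-- A self-homotopy of a morphism from a free crossed complex to an acyclic one is itself
null-homotopic, by a homotopy `s` of one degree higher. -/
theorem IsFree.homotopy_null (hF : F.IsFree) (hD : D.IsAcyclic) {g : Hom F D}
    (H : Homotopy g g) : ∃ (s₁ : F.X 1 → D.X 3) (s : ∀ i, F.X (i + 2) →* D.X (i + 4)),
      (∀ x y, s₁ (x * y) = s₁ x * actVia (g.map 1) 3 x (s₁ y)) ∧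
      (∀ i u x, s i (F.act (i + 2) u x) = actVia (g.map 1) (i + 4) u (s i x)) ∧
      (∀ x, D.δ 2 (s₁ x) = H.h 1 x) ∧
      (∀ x, D.δ 3 (s 0 x) = s₁ (F.δ 1 x) * H.h 2 x) ∧
      ∀ i x, D.δ (i + 4) (s (i + 1) x) = s i (F.δ (i + 2) x) * H.h (i + 3) x := by
  have := hF.one
  have hδ₁ : ∀ x, D.δ 1 (H.h 1 x) = 1 := fun x => by
    simpa using (H.eq_one x).symm
  have hδ : ∀ i x, D.δ (i + 2) (H.h (i + 2) x) = (H.h (i + 1) (F.δ (i + 1) x))⁻¹ := fun i x => by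
    have := H.h_eq (i + 1) x
    rw [eq_comm, mul_eq_right] at this
    exact (inv_eq_of_mul_eq_one_right this).symm
  -- the recursion is `δ sᵢ = (sᵢ₋₁ ∘ δ) · hᵢ`
  obtain ⟨s₁, h1, h1'⟩ := exists_lift_derivation (actVia (g.map 1) 3) (actVia (g.map 1) 2) (D.δ 2)
    (fun u m => D.δ_act 2 _ m) (H.h 1) H.h_one (fun x => hD 0 _ (hδ₁ x))
  have s₁_one : s₁ 1 = 1 := by simpa using h1 1 1
  let hh (i : ℕ) : F.X (i + 2) →* D.X (i + 3) := MonoidHom.mk' (H.h (i + 2)) (H.h_mul _ (by omega))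
  let d : F.X 2 →* D.X 3 := MonoidHom.mk' (fun x => s₁ (F.δ 1 x) * H.h 2 x) fun x y => by
    rw [map_mul (F.δ 1), h1, g.actVia_δ 3 le_rfl, H.h_mul 2 le_rfl]
    exact mul_mul_mul_comm (G := D.X (0 + 3)) _ _ _ _
  obtain ⟨t₀, ht₀, hd⟩ := hF.exists_lift 0 (D.comm 4 (by omega)) (actVia (g.map 1) 4)
    (actVia (g.map 1) 3) (g.actVia_δ 4 (by omega)) (D.δ 3) (fun u m => D.δ_act 3 _ m) d
    (fun u x => by
      have hi : actVia (g.map 1) 3 u (s₁ u⁻¹) = (s₁ u)⁻¹ := by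
        have := h1 u u⁻¹
        rw [mul_inv_cancel, s₁_one] at this
        exact (inv_eq_of_mul_eq_one_right this.symm).symm
      change s₁ (F.δ 1 (F.act 2 u x)) * H.h 2 (F.act 2 u x) =
        actVia (g.map 1) 3 u (s₁ (F.δ 1 x) * H.h 2 x)
      rw [F.δ_act, F.act_conj, h1, h1, map_mul (actVia _ _), MulAut.mul_apply,
        g.actVia_δ 3 le_rfl, hi, H.h_act 2 le_rfl, map_mul, D.comm 3 le_rfl (s₁ u),
        mul_inv_cancel_right]
      rfl)
    (fun x => hD 1 _ (by
      change D.δ 2 (s₁ (F.δ 1 x) * H.h 2 x) = 1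
      rw [map_mul, h1', hδ 0, mul_inv_cancel]))
  obtain ⟨s, rfl, hs, hsδ⟩ := hF.exists_seq (T := fun i => D.X (i + 4))
    (fun i => actVia (g.map 1) (i + 4)) (fun i => D.δ (i + 4)) (fun i u x => D.δ_act (i + 4) _ x)
    (fun i => D.comm (i + 5) (by omega)) (fun i => g.actVia_δ (i + 5) (by omega))
    (fun i t => t.comp (F.δ (i + 2)) * hh (i + 1))
    (fun i t ht u x => by
      change t (F.δ (i + 2) (F.act (i + 3) u x)) * H.h (i + 3) (F.act (i + 3) u x) =
        actVia (g.map 1) (i + 4) u (t (F.δ (i + 2) x) * H.h (i + 3) x)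
      rw [F.δ_act, ht, H.h_act (i + 3) (by omega), map_mul]
      rfl)
    t₀ ht₀
    (fun x => hD 2 _ (by
      change D.δ 3 (t₀ (F.δ 2 x) * H.h 3 x) = 1
      have hd' : D.δ 3 (t₀ (F.δ 2 x)) = s₁ (F.δ 1 (F.δ 2 x)) * H.h 2 (F.δ 2 x) := hd _
      rw [map_mul, hd', hδ 1, F.δ_δ, s₁_one, one_mul, mul_inv_cancel]))
    (fun i t t' h x => hD (i + 3) _ (by
      change D.δ (i + 4) (t' (F.δ (i + 3) x) * H.h (i + 4) x) = 1
      have ht' : D.δ (i + 4) (t' (F.δ (i + 3) x)) =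
        t (F.δ (i + 2) (F.δ (i + 3) x)) * H.h (i + 3) (F.δ (i + 3) x) := h _
      rw [map_mul, ht', hδ (i + 2), F.δ_δ, map_one, one_mul, mul_inv_cancel]))
  exact ⟨s₁, s, h1, hs, h1', hd, hsδ⟩

/-! ### The acyclic complex `ξC` -/

section xi

variable {C : RedCrossedComplex.{u}} (n : ℕ) (hn : 2 ≤ n)

/-- The factor `A` in dimension `n + 1` bounds the `n`-cycles, and nothing is left above. -/
theorem ξ_isAcyclic (hC : C.IsAspherical n) (hC' : ∀ i, n < i → Subsingleton (C.X i)) :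
    (C.ξ n hn).IsAcyclic := by
  suffices h : ∀ i (x : C.X (i + 2)) (a : sub (C.A n hn) (i + 2 = n + 1)),
      (C.ξ n hn).δ (i + 1) (x, a) = 1 → a = 1 ∧
        ∃ (y : C.X (i + 3)) (b : sub (C.A n hn) (i + 3 = n + 1)),
          C.δ (i + 2) y * C.inc n hn (i + 2) b = x by
    rintro i ⟨x, a⟩ hx
    obtain ⟨rfl, y, b, rfl⟩ := h i x a hx
    exact ⟨(y, b), rfl⟩
  intro i x a hx
  rcases lt_trichotomy (i + 2) (n + 1) with hi | hi | hi
  · have ha : a = 1 := Subtype.ext (a.2.resolve_left (by omega))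
    subst ha
    have hx' : C.δ (i + 1) x = 1 := by
      rcases i with _ | i
      · exact hx
      · have h1 : C.δ (i + 2) x * C.inc n hn (i + 2) 1 = 1 := congrArg Prod.fst hx
        rwa [map_one, mul_one] at h1
    refine ⟨rfl, ?_⟩
    rcases eq_or_ne (i + 2) n with rfl | hne
    · refine ⟨1, ⟨⟨x, hx'⟩, Or.inl rfl⟩, ?_⟩
      rw [map_one, one_mul, inc_self]
      rfl
    · obtain ⟨y, rfl⟩ := hC (i + 2) (by omega) (by omega) hx'
      exact ⟨y, 1, by simp⟩
  · have := hC' (i + 2) (by omega)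
    refine ⟨?_, 1, 1, Subsingleton.elim _ _⟩
    obtain ⟨i, rfl⟩ : ∃ j, i = j + 1 := ⟨i - 1, by omega⟩
    obtain rfl : n = i + 2 := by omega
    have h1 : C.δ (i + 2) x * C.inc (i + 2) hn (i + 2) a = 1 := congrArg Prod.fst hx
    rw [Subsingleton.elim x 1, map_one, one_mul, inc_self] at h1
    exact Subtype.ext (Subtype.ext h1)
  · have := hC' (i + 2) (by omega)
    exact ⟨Subtype.ext (a.2.resolve_left (by omega)), 1, 1, Subsingleton.elim _ _⟩

theorem φ_eq_one_iff (u : C.X 1) : C.φ u = 1 ↔ u ∈ ((C.ξ n hn).δ 1).range :=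
  (QuotientGroup.eq_one_iff u).trans
    ⟨fun ⟨x, hx⟩ => ⟨((x, 1) : C.X 2 × sub (C.A n hn) (0 + 2 = n + 1)), hx⟩,
      fun ⟨x, hx⟩ => ⟨x.1, hx⟩⟩

/-- A morphism `F → C`, regarded as a morphism to `ξC` which is trivial in the factor `A`. -/
def toξ (f : Hom F C) : Hom F (C.ξ n hn) where
  map i := match i with
    | 0 => f.map 0
    | 1 => f.map 1
    | i + 2 => (f.map (i + 2)).prod (1 : F.X (i + 2) →* sub (C.A n hn) (i + 2 = n + 1))
  map_δ i := match i with
    | 0 => f.map_δ 0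
    | 1 => f.map_δ 1
    | i + 2 => fun x => Prod.ext (by
        change f.map (i + 2) _ = C.δ (i + 2) (f.map (i + 3) x) * C.inc n hn (i + 2) 1
        rw [f.map_δ, map_one, mul_one]) rfl
  map_act i := match i with
    | 0 => f.map_act 0
    | 1 => f.map_act 1
    | i + 2 => fun u x => Prod.ext (f.map_act (i + 2) u x) (Subtype.ext
        (map_one (C.actA n hn (C.φ (f.map 1 u)))).symm)

end xi

/-- The shift by one dimension between the factor `A` of `ξC` and the group `A` of `K(Q, 1; A, n)`. -/
def subShift (A : Type u) [Group A] (n i : ℕ) : sub A (i + 1 = n + 1) →* sub A (i = n) :=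
  Subgroup.inclusion fun _ => Or.imp_left (by omega)

/-- The component in `A` of an element of `ξC` of dimension `i + 3`, as an element of
`K(Q, 1; A, n)` of dimension `i + 2`. -/
def ξsnd (C : RedCrossedComplex.{u}) (n : ℕ) (hn : 2 ≤ n) (i : ℕ) :
    (C.ξ n hn).X (i + 3) →* (K (C.actA n hn) n).X (i + 2) :=
  (subShift (C.A n hn) n (i + 2)).comp
    (MonoidHom.snd (C.X (i + 3)) (sub (C.A n hn) (i + 3 = n + 1)))

/-- The inverse shift, as a homomorphism into `ξC`. -/
def ξinr (C : RedCrossedComplex.{u}) (n : ℕ) (hn : 2 ≤ n) (i : ℕ) :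
    (K (C.actA n hn) n).X (i + 2) →* sub (C.A n hn) (i + 3 = n + 1) :=
  Subgroup.inclusion fun _ => Or.imp_left fun h => by omega

theorem ξsnd_δ {C : RedCrossedComplex.{u}} {n : ℕ} {hn : 2 ≤ n} (i : ℕ)
    (z : (C.ξ n hn).X (i + 4)) :
    ξsnd C n hn i ((C.ξ n hn).δ (i + 3) z) = 1 := rfl

/-! ### The obstruction class -/

theorem Homotopic.comp_left {F C D : RedCrossedComplex.{u}} (q : Hom C D) {f g : Hom F C} :
    Homotopic f g → Homotopic (q.comp f) (q.comp g) := by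
  rintro ⟨H⟩
  refine ⟨{ h := fun n x => q.map (n + 1) (H.h n x), h_zero := ?_, h_one := ?_, h_mul := ?_,
            h_act := ?_, h_eq := ?_ }⟩
  · simp [H.h_zero]
  · intro x y
    rw [H.h_one, map_mul, q.map_act]
    rfl
  · intro n hn x y
    rw [H.h_mul n hn, map_mul]
  · intro n hn u x
    rw [H.h_act n hn, q.map_act]
    rfl
  · intro n x
    change q.map (n + 1) (f.map (n + 1) x) = _
    rw [H.h_eq n x, map_mul, map_mul, q.map_δ]
    rfl

section obstruction

variable {C : RedCrossedComplex.{u}} {n : ℕ} {hn : 2 ≤ n} {θ : F.π₁ →* C.π₁}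

/-- Two realisations of `θ` differ in dimension `1` by boundaries of `ξC`. -/
theorem Realises.range_one {f g : Hom F C} (hf : Realises θ f) (hg : Realises θ g) (x : F.X 1) :
    f.map 1 x * (g.map 1 x)⁻¹ ∈ ((C.ξ n hn).δ 1).range :=
  (φ_eq_one_iff n hn _).1 (by rw [map_mul, map_inv, hf, hg, mul_inv_cancel])

theorem exists_isObstruction (hF : F.IsFree) (hC : C.IsAspherical n)
    (hC' : ∀ i, n < i → Subsingleton (C.X i)) :
    ∃ k : Cohomology θ (C.actA n hn) (n + 1), IsObstruction n hn θ k := by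
  have hξ := ξ_isAcyclic n hn hC hC'
  have hφ : Function.Surjective C.φ := QuotientGroup.mk'_surjective _
  obtain ⟨f', hf'⟩ := hF.exists_hom hξ (D := C.ξ n hn) C.φ hφ
    (φ_eq_one_iff (C := C) n hn) θ
  refine ⟨Quotient.mk _ ⟨(C.proj n hn).comp f', hf'⟩, ⟨f', hf'⟩, fun g' hg' => ?_⟩
  refine Quotient.sound ((hF.homotopic hξ g' f' fun x => ?_).comp_left _)
  have h1 : C.φ (g'.map 1 x) = θ (F.φ x) := hg' x
  have h2 : C.φ (f'.map 1 x) = θ (F.φ x) := hf' x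
  exact (φ_eq_one_iff (C := C) n hn _).1 ((map_mul C.φ _ _).trans
    ((congrArg₂ _ h1 ((map_inv C.φ _).trans (congrArg _ h2))).trans (mul_inv_cancel _)))

/-- If `p ∘ f'` is null-homotopic by a homotopy `h`, then `h` takes values in `A` in dimension `n`,
and dividing `f'` by `h` in dimension `n` gives a morphism to `C`. -/
theorem exists_realises_of_homotopic_zero (f' : Hom F (C.ξ n hn))
    (hf' : Over θ (C.actA n hn) (n + 1) ((C.proj n hn).comp f'))
    (H : Homotopy ((C.proj n hn).comp f') (KZero θ (C.actA n hn) (n + 1)).1) :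
    ∃ f : Hom F C, Realises θ f := by
  let f₁ : F.X 1 →* C.X 1 := f'.map 1
  -- the correction term, with values in `A` for `i + 2 = n` and trivial otherwise
  let c (i : ℕ) : F.X (i + 2) →* C.X (i + 2) :=
    MonoidHom.mk' (fun x => C.inc n hn (i + 2)
      (Kval (C.actA n hn) (n + 1) (i + 1) (H.h (i + 2) x))⁻¹)
      fun x y => by rw [H.h_mul _ (by omega), map_mul, mul_inv, map_mul]
  have hc : ∀ i x y, c i x * y = y * c i x := fun i x y => C.inc_central n hn _ _ _
  have hδc : ∀ i x, C.δ (i + 1) (c i x) = 1 := fun i x => C.δ_inc n hn _ _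
  have hcδ : ∀ i x, c i (F.δ (i + 2) x) = (C.inc n hn (i + 2) (f'.map (i + 3) x).2.1)⁻¹ := by
    intro i x
    have h1 := H.h_eq (i + 2) x
    rw [Kδ, mul_one] at h1
    have h2 : (f'.map (i + 3) x).2 = H.h (i + 2) (F.δ (i + 2) x) := h1.trans (mul_one _)
    rw [h2, ← map_inv]
    rfl
  have hact : ∀ i u x, c i (F.act (i + 2) u x) = C.act (i + 2) (f₁ u) (c i x) := by
    intro i u x
    have h1 : C.φ (f₁ u) = θ (F.φ u) := hf' u
    change C.inc n hn (i + 2) _ = C.act (i + 2) (f₁ u) (C.inc n hn (i + 2) _)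
    rw [← C.inc_act, h1, H.h_act (i + 2) (by omega), map_inv (C.actA n hn _)]
    rfl
  let m (i : ℕ) : F.X (i + 2) →* C.X (i + 2) :=
    MonoidHom.mk' (fun x => c i x * (f'.map (i + 2) x).1) fun x y => by
      have h1 : (f'.map (i + 2) (x * y)).1 = (f'.map (i + 2) x).1 * (f'.map (i + 2) y).1 :=
        congrArg Prod.fst (map_mul (f'.map (i + 2)) x y)
      rw [h1, map_mul, mul_assoc, mul_assoc, ← mul_assoc (c i y), hc i y, mul_assoc]
  refine ⟨{ map := fun i => match i with
              | 0 => f'.map 0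
              | 1 => f₁
              | i + 2 => m i
            map_δ := fun i => match i with
              | 0 => f'.map_δ 0
              | 1 => fun x => by
                have h1 : f₁ (F.δ 1 x) = C.δ 1 (f'.map 2 x).1 := f'.map_δ 1 x
                change f₁ (F.δ 1 x) = C.δ 1 (c 0 x * (f'.map 2 x).1)
                rw [map_mul, hδc 0, one_mul, h1]
              | i + 2 => fun x => by
                have h1 : (f'.map (i + 2) (F.δ (i + 2) x)).1 =
                    C.δ (i + 2) (f'.map (i + 3) x).1 * C.inc n hn (i + 2) (f'.map (i + 3) x).2.1 :=
                  congrArg Prod.fst (f'.map_δ (i + 2) x)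
                change c i (F.δ (i + 2) x) * (f'.map (i + 2) (F.δ (i + 2) x)).1 =
                  C.δ (i + 2) (c (i + 1) x * (f'.map (i + 3) x).1)
                rw [h1, hcδ, map_mul, hδc (i + 1), one_mul, ← C.inc_central, inv_mul_cancel_left]
            map_act := fun i => match i with
              | 0 => f'.map_act 0
              | 1 => f'.map_act 1
              | i + 2 => fun u x => by
                have h1 : (f'.map (i + 2) (F.act (i + 2) u x)).1 =
                    C.act (i + 2) (f₁ u) (f'.map (i + 2) x).1 :=
                  congrArg Prod.fst (f'.map_act (i + 2) u x)
                change c i (F.act (i + 2) u x) * (f'.map (i + 2) (F.act (i + 2) u x)).1 =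
                  C.act (i + 2) (f₁ u) (c i x * (f'.map (i + 2) x).1)
                rw [h1, hact, map_mul] }, hf'⟩

theorem IsObstruction.eq_zero_iff {k : Cohomology θ (C.actA n hn) (n + 1)}
    (hk : IsObstruction n hn θ k) : k = 0 ↔ ∃ f : Hom F C, Realises θ f := by
  obtain ⟨⟨f', hf'⟩, huniq⟩ := hk
  constructor
  · intro h0
    obtain ⟨H⟩ := Quotient.exact ((huniq f' hf').trans h0)
    exact exists_realises_of_homotopic_zero f' hf' H
  · rintro ⟨f, hf⟩
    rw [← huniq (toξ n hn f) hf]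
    exact congrArg (Quotient.mk _) (KHom_ext fun i x => rfl)

/-! ### The action of cohomology on homotopy classes -/

/-- Any two morphisms realising `θ` become homotopic in `ξC`; the `A`-component of the homotopy is a
cocycle by which they differ up to homotopy in `C`. -/
theorem exists_translate_homotopic (hF : F.IsFree) (hC : C.IsAspherical n)
    (hC' : ∀ i, n < i → Subsingleton (C.X i)) (f g : {f : Hom F C // Realises θ f}) :
    ∃ a : {f : Hom F (K (C.actA n hn) n) // Over θ (C.actA n hn) n f},
      Homotopic (translate a g).1 f.1 := by
  obtain ⟨H⟩ := hF.homotopic (ξ_isAcyclic n hn hC hC') (toξ n hn f.1) (toξ n hn g.1)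
    (f.2.range_one g.2)
  let h (i : ℕ) : F.X (i + 2) →* (C.ξ n hn).X (i + 3) :=
    MonoidHom.mk' (H.h (i + 2)) (H.h_mul _ (by omega))
  let a := KHom θ (C.actA n hn) n (fun i => (ξsnd C n hn i).comp (h i))
    (fun i x => by
      have h1 := congrArg (ξsnd C n hn i) (H.h_eq (i + 2) x)
      rw [map_mul, map_mul, ξsnd_δ, mul_one] at h1
      exact (h1.trans (mul_one _)).symm)
    (fun i u x => by
      have h1 := congrArg (ξsnd C n hn i) (H.h_act (i + 2) (by omega) u x)
      rw [← g.2]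
      exact h1)
  refine ⟨a, Homotopic.symm (Homotopic.of_components (fun x => (H.h 1 x).1)
    (fun i => (MonoidHom.fst (C.X (i + 3)) (sub (C.A n hn) (i + 3 = n + 1))).comp (h i))
    (fun x y => congrArg Prod.fst (H.h_one x y))
    (fun i u x => congrArg Prod.fst (H.h_act (i + 2) (by omega) u x))
    H.eq_one (fun x => ?_) (fun i x => ?_))⟩
  · have h1 : f.1.map 2 x = (H.h 1 (F.δ 1 x)).1 *
        (C.δ 2 (H.h 2 x).1 * C.inc n hn 2 (H.h 2 x).2.1) * g.1.map 2 x :=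
      congrArg Prod.fst (H.h_eq 1 x)
    rw [h1, translate_map a g 0]
    simp only [mul_assoc]
    rfl
  · have h1 : f.1.map (i + 3) x = (H.h (i + 2) (F.δ (i + 2) x)).1 *
        (C.δ (i + 3) (H.h (i + 3) x).1 * C.inc n hn (i + 3) (H.h (i + 3) x).2.1) *
          g.1.map (i + 3) x :=
      congrArg Prod.fst (H.h_eq (i + 2) x)
    rw [h1, translate_map a g (i + 1)]
    simp only [mul_assoc]
    rfl

/-- A homotopy from the translate of `f` by `a` to `f` gives, together with `-a`, a self-homotopy of
`f` in `ξC`. -/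
def selfHomotopy {a : {f : Hom F (K (C.actA n hn) n) // Over θ (C.actA n hn) n f}}
    {f : {f : Hom F C // Realises θ f}} (H : Homotopy (translate a f).1 f.1) :
    Homotopy (toξ n hn f.1) (toξ n hn f.1) where
  h i := match i with
    | 0 => fun _ => 1
    | 1 => fun x => (show C.X 2 × sub (C.A n hn) (0 + 2 = n + 1) from (H.h 1 x, 1))
    | i + 2 => fun x => (show C.X (i + 3) × sub (C.A n hn) (i + 3 = n + 1) from
        (H.h (i + 2) x, (ξinr C n hn i (a.1.map (i + 2) x))⁻¹))
  h_zero _ := rfl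
  h_one x y := Prod.ext (H.h_one x y) (by
    change (1 : sub (C.A n hn) (0 + 2 = n + 1)) = 1 * _
    rw [one_mul]
    exact Subtype.ext (map_one (C.actA n hn (C.φ (f.1.map 1 x)))).symm)
  h_mul i hi x y := by
    obtain ⟨i, rfl⟩ : ∃ j, i = j + 2 := ⟨i - 2, by omega⟩
    refine Prod.ext (H.h_mul _ hi x y) ?_
    change (ξinr C n hn i (a.1.map (i + 2) (x * y)))⁻¹ =
      (ξinr C n hn i (a.1.map (i + 2) x))⁻¹ * (ξinr C n hn i (a.1.map (i + 2) y))⁻¹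
    rw [map_mul, map_mul, mul_inv]
  h_act i hi u x := by
    obtain ⟨i, rfl⟩ : ∃ j, i = j + 2 := ⟨i - 2, by omega⟩
    refine Prod.ext (H.h_act _ hi u x) (Subtype.ext ?_)
    change (Kval (C.actA n hn) n i (a.1.map (i + 2) (F.act (i + 2) u x)))⁻¹ =
      C.actA n hn (C.φ (f.1.map 1 u)) (Kval (C.actA n hn) n i (a.1.map (i + 2) x))⁻¹
    rw [a.1.map_act, a.2, f.2, map_inv]
    rfl
  h_eq i := match i with
    | 0 => fun x => by
      rw [one_mul]
      exact H.eq_one x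
    | 1 => fun x => by
      refine Prod.ext ?_ ((mul_one _).trans (mul_one _)).symm
      have h1 := H.h_eq 1 x
      rw [translate_map a f 0] at h1
      change f.1.map 2 x = H.h 1 (F.δ 1 x) * (C.δ 2 (H.h 2 x) *
        C.inc n hn 2 (Kval (C.actA n hn) n 0 (a.1.map 2 x))⁻¹) * f.1.map 2 x
      have h2 : C.inc n hn 2 (Kval (C.actA n hn) n 0 (a.1.map 2 x)) = _ := mul_right_cancel h1
      rw [map_inv, h2, ← mul_assoc, mul_inv_cancel, one_mul]
    | i + 2 => fun x => by
      refine Prod.ext ?_ ?_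
      · have h1 := H.h_eq (i + 2) x
        rw [translate_map a f (i + 1)] at h1
        change f.1.map (i + 3) x = H.h (i + 2) (F.δ (i + 2) x) * (C.δ (i + 3) (H.h (i + 3) x) *
          C.inc n hn (i + 3) (Kval (C.actA n hn) n (i + 1) (a.1.map (i + 3) x))⁻¹) *
            f.1.map (i + 3) x
        have h2 : C.inc n hn (i + 3) (Kval (C.actA n hn) n (i + 1) (a.1.map (i + 3) x)) = _ :=
          mul_right_cancel h1
        rw [map_inv, h2, ← mul_assoc, mul_inv_cancel, one_mul]
      · change (1 : sub (C.A n hn) (i + 3 = n + 1)) =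
          (ξinr C n hn i (a.1.map (i + 2) (F.δ (i + 2) x)))⁻¹ * 1 * 1
        rw [a.1.map_δ, Kδ, map_one, inv_one, one_mul, one_mul]

/-- The cocycle `a` is bounded by the `A`-component of a nullity of `selfHomotopy H`. -/
theorem eq_zero_of_translate_homotopic (hF : F.IsFree) (hC : C.IsAspherical n)
    (hC' : ∀ i, n < i → Subsingleton (C.X i))
    {a : {f : Hom F (K (C.actA n hn) n) // Over θ (C.actA n hn) n f}}
    {f : {f : Hom F C // Realises θ f}} (H : Homotopy (translate a f).1 f.1) :
    Homotopic a.1 (KZero θ (C.actA n hn) n).1 := by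
  obtain ⟨s₁, s, h1, hs, -, h2, h3⟩ :=
    hF.homotopy_null (ξ_isAcyclic n hn hC hC') (selfHomotopy H)
  have hφ : ∀ u, C.φ (f.1.map 1 u) = (KZero θ (C.actA n hn) n).1.map 1 u := f.2
  refine Homotopic.of_components (fun x => ξsnd C n hn 0 (s₁ x))
    (fun i => (ξsnd C n hn (i + 1)).comp (s i)) (fun x y => ?_) (fun i u x => ?_) (fun x => ?_)
    (fun x => ?_) (fun i x => ?_)
  · rw [h1, map_mul, actVia_apply, actVia_apply, ← hφ]
    rfl
  · rw [MonoidHom.comp_apply, hs, actVia_apply, actVia_apply, ← hφ]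
    rfl
  · rw [Kδ, one_mul, a.2]
    rfl
  · have h := congrArg (ξsnd C n hn 0) (h2 x)
    rw [ξsnd_δ, map_mul] at h
    rw [Kδ, mul_one]
    refine Eq.trans ?_ (mul_one _).symm
    exact (mul_inv_eq_one.1 h.symm).symm
  · have h := congrArg (ξsnd C n hn (i + 1)) (h3 i x)
    rw [ξsnd_δ, map_mul] at h
    rw [Kδ, mul_one]
    refine Eq.trans ?_ (mul_one _).symm
    exact (mul_inv_eq_one.1 h.symm).symm

theorem eq_zero_of_vadd_eq (hF : F.IsFree) (hC : C.IsAspherical n)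
    (hC' : ∀ i, n < i → Subsingleton (C.X i)) (a : Cohomology θ (C.actA n hn) n)
    (x : Classes F C θ) (h : a +ᵥ x = x) : a = 0 := by
  induction a using Quotient.inductionOn with | _ a =>
  induction x using Quotient.inductionOn with | _ f =>
  obtain ⟨H⟩ := Quotient.exact h
  exact Quotient.sound (eq_zero_of_translate_homotopic hF hC hC' H)

theorem vadd_bijective (hF : F.IsFree) (hC : C.IsAspherical n)
    (hC' : ∀ i, n < i → Subsingleton (C.X i)) (x : Classes F C θ) :
    Function.Bijective fun a : Cohomology θ (C.actA n hn) n => a +ᵥ x := by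
  constructor
  · intro a b hab
    have hab' : a +ᵥ x = b +ᵥ x := hab
    have h : (-b + a) +ᵥ x = x := by rw [add_vadd, hab', neg_vadd_vadd]
    exact (neg_add_eq_zero.1 (eq_zero_of_vadd_eq hF hC hC' _ x h)).symm
  · intro y
    induction x using Quotient.inductionOn with | _ g =>
    induction y using Quotient.inductionOn with | _ f =>
    obtain ⟨a, ha⟩ := exists_translate_homotopic (hn := hn) hF hC hC' f g
    exact ⟨Quotient.mk _ a, Quotient.sound ha⟩

end obstruction

end RedCrossedComplex

open RedCrossedComplex in
theorem theorem3p10 (n : ℕ) (hn : 2 ≤ n) (F C : RedCrossedComplex.{u}) (hF : F.IsFree)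
    (hC : C.IsAspherical n) (hC' : ∀ i, n < i → Subsingleton (C.X i)) (θ : F.π₁ →* C.π₁) :
    ∃ k : Cohomology θ (C.actA n hn) (n + 1),
      IsObstruction n hn θ k ∧
      (k = 0 ↔ ∃ f : Hom F C, Realises θ f) ∧
      (k = 0 →
        Nonempty (Classes F C θ ≃ Cohomology θ (C.actA n hn) n) ∧
        (∀ (a : Cohomology θ (C.actA n hn) n) (x : Classes F C θ), a +ᵥ x = x → a = 0) ∧
        ∀ x : Classes F C θ,
          Function.Bijective fun a : Cohomology θ (C.actA n hn) n => a +ᵥ x) := by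
  obtain ⟨k, hk⟩ := exists_isObstruction (hn := hn) (θ := θ) hF hC hC'
  refine ⟨k, hk, hk.eq_zero_iff, fun h0 => ⟨?_, eq_zero_of_vadd_eq hF hC hC',
    vadd_bijective hF hC hC'⟩⟩
  obtain ⟨f, hf⟩ := hk.eq_zero_iff.1 h0
  let x : Classes F C θ := Quotient.mk _ ⟨f, hf⟩
  exact ⟨(Equiv.ofBijective _ (vadd_bijective hF hC hC' x)).symm⟩
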